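/- **Theorem (Overparameterization).** Let $\mathbb S^n$ be the space of real symmetric $n\times n$ matrices with the Frobenius norm $\|E\|_F=\sqrt{\operatorname{tr}(E^TE)}$. Call $\phi:\mathbb S^n\to\mathbb R$ *$L$-smooth and $\mu$-strongly convex* ($\mu>0$) if it is twice differentiable and $$\mu\|E\|_F^2\le\langle\nabla^2\phi(M)[E],E\rangle\le L\|E\|_F^2\qquad\text{for all }M,E\in\mathbb S^n .$$ Write $M^\star=\arg\min_{M\succeq0}\phi(M)$ and $f(U)=\phi(UU^T)$ for $U\in\mathbb R^{n\times r}$. Let $n,r,r^\star$ be integers with $0\le r^\star\le r<n$. * (Sufficiency) If $\phi$ is twice differentiable, $L$-smooth and $\mu$-strongly convex, $\operatorname{rank}(M^\star)=r^\star$, and $r>\frac14(L/\mu-1)^2\,r^\star$, then for every $X\in\mathbb R^{n\times r}$ $$\nabla f(X)=0,\quad\nabla^2f(X)\succeq0\quad\iff\quad f(X)=\min_Uf(U).$$ * (Necessity) If $r^\star\ge1$, $0<\mu\le L$ and $r\le\frac14(L/\mu-1)^2+r^\star-1$, then there is a quadratic function $\phi_0:\mathbb S^n\to\mathbb R$ that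 is $L$-smooth and $\mu$-strongly convex, whose minimizer $M_0^\star=\arg\min_{M\succeq0}\phi_0(M)$ has rank $r^\star$, and for which $f_0(U)=\phi_0(UU^T)$ has a point $X_{\rm spur}\in\mathbb R^{n\times r}$ with $$\nabla f_0(X_{\rm spur})=0,\quad\nabla^2f_0(X_{\rm spur})\succeq0,\quad f_0(X_{\rm spur})-\min_Uf_0(U)>\mu .$$ * (Best condition number) Call $\phi$ a $(\kappa,r,r^\star)$-counterexample if it is twice differentiable, $L$-smooth and $\mu$-strongly convex for some $L,\mu$ with $L/\mu\le\kappa$, $\operatorname{rank}(M^\star)=r^\star\le r$, and there is $X\in\mathbb R^{n\times r}$ with $XX^T\ne M^\star$, $\nabla f(X)=0$ and $\nabla^2f(X)\succeq0$. If $r^\star\ge1$, then counterexamples exist, and the infimum $\kappa^\star$ of all $\kappa$ for which a $(\kappa,r,r^\star)$-counterexample $\phi:\mathbb S^n\to\mathbb R$ exists satisfies $$1+2\sqrt{r/r^\star}\le\kappa^\star\le1+2\sqrt{r-r^\star+1}.$$ -/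

import Mathlib

/- Matrices carry the Frobenius norm `‖A‖ = √(∑ i j, A i j ^ 2) = √(tr (Aᵀ A))`. -/
attribute [local instance] Matrix.frobeniusNormedAddCommGroup Matrix.frobeniusNormedSpace

namespace BurerMonteiro

/-- The subspace of real symmetric matrices among all `n × n` matrices. -/
def symSubmodule (n : ℕ) : Submodule ℝ (Matrix (Fin n) (Fin n) ℝ) where
  carrier := {A | A.IsSymm}
  add_mem' := fun hA hB => Matrix.IsSymm.add hA hB
  zero_mem' := Matrix.isSymm_zero
  smul_mem' := fun c _ hA => Matrix.IsSymm.smul hA c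

/-- The space of real symmetric `n × n` matrices, a normed space under the Frobenius norm
inherited from all matrices; `M.1` is the underlying matrix of `M`. -/
def SymMatrix (n : ℕ) : Type := symSubmodule n

noncomputable instance (n : ℕ) : NormedAddCommGroup (SymMatrix n) :=
  inferInstanceAs (NormedAddCommGroup (symSubmodule n))

noncomputable instance (n : ℕ) : NormedSpace ℝ (SymMatrix n) :=
  inferInstanceAs (NormedSpace ℝ (symSubmodule n))

/-- The symmetric matrix `U Uᵀ` of an `n × r` factor `U`. -/
def outer {n r : ℕ} (U : Matrix (Fin n) (Fin r) ℝ) : SymMatrix n :=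
  ⟨U * U.transpose, by simp [symSubmodule, Matrix.IsSymm]⟩

/-- The Burer--Monteiro function `f(U) = φ(U Uᵀ)` on `n × r` matrices. -/
def bm {n : ℕ} (r : ℕ) (φ : SymMatrix n → ℝ) (U : Matrix (Fin n) (Fin r) ℝ) : ℝ :=
  φ (outer U)

/-- `φ` is twice (Fréchet) differentiable, `L`-smooth and `μ`-strongly convex with `μ > 0`:
`μ ‖E‖² ≤ ∇²φ(M)[E, E] ≤ L ‖E‖²` for all points `M` and directions `E`. -/
structure SmoothStronglyConvex {S : Type*} [NormedAddCommGroup S] [NormedSpace ℝ S]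
    (L μ : ℝ) (φ : S → ℝ) : Prop where
  pos : 0 < μ
  differentiable : Differentiable ℝ φ
  differentiable_fderiv : Differentiable ℝ (fderiv ℝ φ)
  strongly_convex : ∀ M E : S, μ * ‖E‖ ^ 2 ≤ fderiv ℝ (fderiv ℝ φ) M E E
  smooth : ∀ M E : S, fderiv ℝ (fderiv ℝ φ) M E E ≤ L * ‖E‖ ^ 2

/-- `M = argmin {φ(N) : N ⪰ 0}`. -/
def IsPSDMinimizer {n : ℕ} (φ : SymMatrix n → ℝ) (M : SymMatrix n) : Prop :=
  M.1.PosSemidef ∧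
    ∀ N : SymMatrix n, N.1.PosSemidef → φ M ≤ φ N

/-- `X` is a second-order critical point of `f`: `∇f(X) = 0` and `∇²f(X) ⪰ 0`. -/
def IsSecondOrderPoint {W : Type*} [NormedAddCommGroup W] [NormedSpace ℝ W]
    (f : W → ℝ) (X : W) : Prop :=
  fderiv ℝ f X = 0 ∧ ∀ V : W, 0 ≤ fderiv ℝ (fderiv ℝ f) X V V

/-- `φ` is a quadratic function: a quadratic form plus a linear form plus a constant. -/
def IsQuadratic {n : ℕ} (φ : SymMatrix n → ℝ) : Prop :=
  ∃ (Q : QuadraticForm ℝ (SymMatrix n)) (l : SymMatrix n →ₗ[ℝ] ℝ) (c : ℝ),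
    ∀ M, φ M = Q M + l M + c

/-- `φ` is a `(κ, r, r⋆)`-counterexample. -/
def IsCounterexample {n : ℕ} (κ : ℝ) (r rs : ℕ) (φ : SymMatrix n → ℝ) : Prop :=
  (∃ L μ : ℝ, SmoothStronglyConvex L μ φ ∧ L / μ ≤ κ) ∧
  ∃ M : SymMatrix n, IsPSDMinimizer φ M ∧
    M.1.rank = rs ∧ rs ≤ r ∧
    ∃ X : Matrix (Fin n) (Fin r) ℝ, outer X ≠ M ∧ IsSecondOrderPoint (bm r φ) X

/-- All `κ` for which a `(κ, r, r⋆)`-counterexample on symmetric `n × n` matrices exists. -/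
def counterexampleSet (n r rs : ℕ) : Set ℝ :=
  {κ | ∃ φ : SymMatrix n → ℝ, IsCounterexample κ r rs φ}

/-- The condition number `κ⋆` of the best-conditioned counterexample. -/
noncomputable def kappaStar (n r rs : ℕ) : ℝ := sInf (counterexampleSet n r rs)

end BurerMonteiro

namespace BurerMonteiro

open Matrix Filter Topology

/-! Sufficiency. Let G and H be the gradients of φ at XXᵀ and at M⋆ = ZZᵀ, and let σ be the least
eigenvalue of XᵀX. Criticality gives GX = 0. Testing the Hessian on v wᵀ, with w a bottom right
singular vector of X, gives vᵀGv ≥ -Lσ|v|² for v orthogonal to the columns of X. If σ = 0, the same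
test gives G ⪰ 0 and convexity finishes (`eq_or_gradient_nonneg`).

If σ > 0, put E = XXᵀ - ZZᵀ. The only further facts needed are H ⪰ 0, ⟨H, E⟩ ≥ 0 and ‖G - H‖² - (L +
μ)⟨G - H, E⟩ + Lμ‖E‖² ≤ 0 (`gradient_difference_bound`). Rotate Z so that the components of its
columns orthogonal to X are pairwise orthogonal, with squared lengths t_j; let c_j ∈ [0, Lσ] be the
negative curvature of G along them, and m_j = min(t_j, σ). Then ⟨G - H, E⟩ ≤ ∑ c_j t_j, ‖G - H‖² ≥ ∑
c_j², and, by `penalized_distance_lower_bound`, ‖E‖² ≥ (r - r⋆)σ² + ∑ (2σ m_j - m_j² + t_j²). With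
`scalar_certificate` these combine to (1 - K) ∑ m_j + (r - r⋆)σ ≤ 0, where K = (L/μ - 1)²/4. Since
m_j ≤ σ and K r⋆ < r, this forces K < 1 and every t_j = 0; then ⟨G - H, E⟩ ≤ 0, so E = 0.

Necessity. A Hessian L·id minus a rank-one form, with all data diagonal, makes the first r basis
vectors a critical point whose gradient has a single nonzero entry -L, just outside their span; the
Hessian term compensates it.

Best condition number. The lower bound is the contrapositive of sufficiency together with uniqueness
of the minimizer; the upper bound is the equality case of necessity. -/

/-! ### Orthogonal normal forms and the distance bound -/

lemma trace_transpose_mul_self_eq_sum {m k : Type*} [Fintype m] [Fintype k] (A : Matrix m k ℝ) :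
    trace (Aᵀ * A) = ∑ i, ∑ j, A i j ^ 2 := by
  simp only [trace, diag, mul_apply, transpose_apply]
  rw [Finset.sum_comm]
  simp [sq]

lemma exists_orthogonal_diagonal {m : ℕ} (A : Matrix (Fin m) (Fin m) ℝ) (hA : A.IsSymm) :
    ∃ (U : Matrix (Fin m) (Fin m) ℝ) (t : Fin m → ℝ),
      Uᵀ * U = 1 ∧ Monotone t ∧ Uᵀ * A * U = diagonal t := by
  have hH : A.IsHermitian := by
    rw [IsHermitian, conjTranspose_eq_transpose_of_trivial]; exact hA
  set σ := Tuple.sort hH.eigenvalues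
  set V : Matrix (Fin m) (Fin m) ℝ := ↑hH.eigenvectorUnitary
  have hV : Vᵀ * V = 1 := by
    have := hH.eigenvectorUnitary.2
    rw [mem_unitaryGroup_iff', star_eq_conjTranspose, conjTranspose_eq_transpose_of_trivial] at this
    exact this
  have hVA : Vᵀ * A * V = diagonal hH.eigenvalues := by
    have h2 : A * V = V * diagonal hH.eigenvalues := by
      ext i j
      have := congrFun (hH.mulVec_eigenvectorBasis j) i
      rw [mul_diagonal]
      simpa [mulVec, dotProduct, mul_apply, V, mul_comm] using this
    rw [Matrix.mul_assoc, h2, ← Matrix.mul_assoc, hV, Matrix.one_mul]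
  refine ⟨V.submatrix id σ, hH.eigenvalues ∘ σ, ?_, Tuple.monotone_sort _, ?_⟩
  · have : (V.submatrix id σ)ᵀ * V.submatrix id σ = (Vᵀ * V).submatrix σ σ := by
      ext; simp [mul_apply]
    rw [this, hV]
    simp
  · have : (V.submatrix id σ)ᵀ * A * V.submatrix id σ = (Vᵀ * A * V).submatrix σ σ := by
      ext; simp [mul_apply]
    rw [this, hVA]
    ext i j
    simp [diagonal_apply]

lemma exists_orthogonal_triangular {s d : ℕ} (C : Matrix (Fin (s + d)) (Fin s) ℝ) :
    ∃ B : Matrix (Fin (s + d)) (Fin (s + d)) ℝ, Bᵀ * B = 1 ∧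
      ∀ i j, j.val < i.val → (Bᵀ * C) i j = 0 := by
  -- Padding with zero vectors lets Gram–Schmidt complete the columns of C to a full orthonormal
  -- basis.
  set f : Fin (s + d) → EuclideanSpace ℝ (Fin (s + d)) :=
    Fin.addCases (fun j => WithLp.toLp 2 (C.col j)) (fun _ => 0)
  set b := InnerProductSpace.gramSchmidtOrthonormalBasis (𝕜 := ℝ) (by simp) f with hb
  refine ⟨of fun k i => b i k, ?_, fun i j hij => ?_⟩
  · ext i j
    have := orthonormal_iff_ite.1 b.orthonormal i j
    simpa [mul_apply, PiLp.inner_apply, one_apply, mul_comm] using this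
  · have h := InnerProductSpace.gramSchmidtOrthonormalBasis_inv_triangular (𝕜 := ℝ)
      (h := by simp) f (i := Fin.castAdd d j) (j := i) (by simpa [Fin.lt_def] using hij)
    simpa [mul_apply, PiLp.inner_apply, mul_comm, f, ← hb] using h

lemma exists_factor_of_rank {n s : ℕ} {M : Matrix (Fin n) (Fin n) ℝ} (hM : M.PosSemidef)
    (hr : M.rank = s) : ∃ Z : Matrix (Fin n) (Fin s) ℝ, M = Z * Zᵀ := by
  classical
  set d := hM.1.eigenvalues
  have hd : ∀ i, 0 ≤ d i := hM.eigenvalues_nonneg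
  set V : Matrix (Fin n) (Fin n) ℝ := ↑hM.1.eigenvectorUnitary
  have hMV : M = V * diagonal d * Vᵀ := by
    have := hM.1.spectral_theorem
    rw [Unitary.conjStarAlgAut_apply] at this
    rw [← conjTranspose_eq_transpose_of_trivial]
    exact this
  have hc : Fintype.card {i // d i ≠ 0} = s := by rw [← hM.1.rank_eq_card_non_zero_eigs, hr]
  let e : Fin s ≃ {i // d i ≠ 0} := (Fintype.equivFinOfCardEq hc).symm
  refine ⟨of fun i k => V i (e k) * √(d (e k)), ?_⟩
  ext i j
  rw [hMV, mul_apply, mul_apply]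
  simp only [mul_diagonal, transpose_apply, of_apply]
  rw [Equiv.sum_comp e (fun k : {i // d i ≠ 0} => V i k * √(d k) * (V j k * √(d k))),
    ← Finset.sum_subtype (Finset.univ.filter fun i => d i ≠ 0) (by simp)
      (fun k => V i k * √(d k) * (V j k * √(d k))), Finset.sum_filter_of_ne]
  · refine Finset.sum_congr rfl fun k _ => ?_
    linear_combination (-V i k * V j k) * Real.mul_self_sqrt (hd k)
  · intro k _ hk h0
    simp [h0] at hk

/-- Discard the off-diagonal entries and use D_ii² ≥ 2 y_i D_ii - y_i²; y is a dual variable to be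
chosen later. -/
lemma diag_certificate {m : ℕ} (D : Matrix (Fin m) (Fin m) ℝ) (y : Fin m → ℝ) :
    ∑ i, (2 * y i * D i i - y i ^ 2) ≤ trace (Dᵀ * D) := by
  rw [trace_transpose_mul_self_eq_sum]
  refine Finset.sum_le_sum fun i _ => ?_
  have := Finset.single_le_sum (f := fun j => D i j ^ 2) (fun j _ => sq_nonneg _)
    (Finset.mem_univ i)
  nlinarith [sq_nonneg (D i i - y i)]

/-- Lower bound for the distance from a matrix `Λ ⪰ σ` to a positive semidefinite matrix `C Cᵀ` of
rank at most `s`, penalized by a weighted norm of the columns of `C`. -/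
lemma penalized_distance_lower_bound {s d : ℕ} {l : Fin (s + d) → ℝ} {σ : ℝ} (hσ : 0 ≤ σ)
    (hl : ∀ k, σ ≤ l k) (C : Matrix (Fin (s + d)) (Fin s) ℝ) {t : Fin s → ℝ} (ht : Monotone t)
    (ht0 : ∀ j, 0 ≤ t j) :
    d * σ ^ 2 + ∑ j, (2 * σ * min (t j) σ - min (t j) σ ^ 2) ≤
      trace ((diagonal l - C * Cᵀ)ᵀ * (diagonal l - C * Cᵀ)) +
        2 * trace (C * diagonal t * Cᵀ) := by
  obtain ⟨B, hB, hT⟩ := exists_orthogonal_triangular C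
  have hB' : B * Bᵀ = 1 := mul_eq_one_comm.1 hB
  set R := Bᵀ * C with hR
  set A := diagonal l - C * Cᵀ with hA
  set D := Bᵀ * A * B with hD
  have h1 : trace (Aᵀ * A) = trace (Dᵀ * D) := by
    have : Dᵀ * D = Bᵀ * (Aᵀ * A * B) := by
      rw [hD]
      simp only [transpose_mul, transpose_transpose, Matrix.mul_assoc]
      rw [← Matrix.mul_assoc B, hB', Matrix.one_mul]
    rw [this, trace_mul_comm Bᵀ, Matrix.mul_assoc, hB', Matrix.mul_one]
  have hCR : C = B * R := by rw [hR, ← Matrix.mul_assoc, hB', Matrix.one_mul]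
  have h2 : trace (C * diagonal t * Cᵀ) = ∑ i, ∑ j, t j * R i j ^ 2 := by
    have : C * diagonal t * Cᵀ = B * (R * diagonal t * Rᵀ * Bᵀ) := by
      conv_lhs => rw [hCR]
      simp only [transpose_mul, Matrix.mul_assoc]
    rw [this, trace_mul_comm B, Matrix.mul_assoc, hB, Matrix.mul_one]
    refine Finset.sum_congr rfl fun i _ => ?_
    rw [diag, mul_apply]
    simp only [mul_diagonal, transpose_apply]
    exact Finset.sum_congr rfl fun j _ => by ring
  have h3 : ∀ i, σ - ∑ j, R i j ^ 2 ≤ D i i := by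
    intro i
    have e1 : D = Bᵀ * diagonal l * B - R * Rᵀ := by
      rw [hD, hA, hR]
      simp only [transpose_mul, transpose_transpose, Matrix.mul_assoc, Matrix.mul_sub,
        Matrix.sub_mul]
    have e2 : ∑ k, B k i ^ 2 = 1 := by
      have := congrFun (congrFun hB i) i
      simpa [mul_apply, sq] using this
    have e3 : D i i = ∑ k, l k * B k i ^ 2 - ∑ j, R i j ^ 2 := by
      rw [e1, Matrix.sub_apply, mul_apply, mul_apply]
      simp only [mul_diagonal, transpose_apply, ← sq]
      congr 1
      exact Finset.sum_congr rfl fun j _ => by ring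
    have e4 : σ ≤ ∑ k, l k * B k i ^ 2 := by
      calc σ = ∑ k, σ * B k i ^ 2 := by rw [← Finset.mul_sum, e2, mul_one]
        _ ≤ _ := Finset.sum_le_sum fun k _ => mul_le_mul_of_nonneg_right (hl k) (sq_nonneg _)
    linarith
  -- Dual variable: R is upper triangular and t increasing, so row i of R only meets weights t_j ≥
  -- t_i ≥ y_i, and rows from s on vanish. The penalty thus absorbs the loss ∑ R_ij² in D_ii.
  set y : Fin (s + d) → ℝ := Fin.addCases (fun j => min (t j) σ) (fun _ => σ) with hy
  have hy0 : ∀ i, 0 ≤ y i := by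
    intro i
    refine Fin.addCases (fun j => ?_) (fun j => ?_) i
    · simp [hy, hσ, ht0]
    · simp [hy, hσ]
  have hyR : ∀ i j, y i * R i j ^ 2 ≤ t j * R i j ^ 2 := by
    intro i j
    by_cases hij : j.val < i.val
    · rw [hT i j hij]; simp
    · refine mul_le_mul_of_nonneg_right ?_ (sq_nonneg _)
      have hi : i.val < s := by omega
      have : i = Fin.castAdd d ⟨i, hi⟩ := by ext; rfl
      rw [this]
      simp only [hy, Fin.addCases_left]
      refine (min_le_left _ _).trans (ht ?_)
      rw [Fin.le_def]; simpa using hij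
  have h4 : ∑ i, (2 * σ * y i - y i ^ 2) =
      d * σ ^ 2 + ∑ j, (2 * σ * min (t j) σ - min (t j) σ ^ 2) := by
    rw [Fin.sum_univ_add]
    simp only [hy, Fin.addCases_left, Fin.addCases_right, Finset.sum_const, Finset.card_univ,
      Fintype.card_fin, nsmul_eq_mul]
    ring
  rw [← h4, h1, h2]
  have h5 := diag_certificate D y
  refine le_trans ?_ (add_le_add_left h5 _)
  rw [Finset.mul_sum, ← Finset.sum_add_distrib]
  refine Finset.sum_le_sum fun i _ => ?_
  have h6 : y i * ∑ j, R i j ^ 2 ≤ ∑ j, t j * R i j ^ 2 := by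
    rw [Finset.mul_sum]
    exact Finset.sum_le_sum fun j _ => hyR i j
  nlinarith [mul_le_mul_of_nonneg_left (h3 i) (hy0 i)]

/-! ### Scalar inequalities -/

/-- Complete the square in t. What remains decreases in c, so the worst case is c = Lσ, and this
produces the constant (L/μ - 1)²/4. -/
lemma scalar_certificate_of_le {L μ σ c t : ℝ} (hμ : 0 < μ) (hL : μ ≤ L)
    (hc0 : 0 ≤ c) (hc : c ≤ L * σ) :
    L * μ * σ ^ 2 * (1 - 1 / 4 * (L / μ - 1) ^ 2) ≤
      c ^ 2 - (L + μ) * c * t + L * μ * (σ ^ 2 + t ^ 2) := by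
  have hL0 : 0 < L := hμ.trans_le hL
  have h1 : c ^ 2 ≤ L ^ 2 * σ ^ 2 := by nlinarith
  have h2 : c ^ 2 - (L + μ) * c * t + L * μ * (σ ^ 2 + t ^ 2) -
      L * μ * σ ^ 2 * (1 - 1 / 4 * (L / μ - 1) ^ 2) =
      L * μ * (t - (L + μ) * c / (2 * L * μ)) ^ 2 +
        (L - μ) ^ 2 / (4 * L * μ) * (L ^ 2 * σ ^ 2 - c ^ 2) := by
    field_simp
    ring
  have h3 : 0 ≤ L * μ * (t - (L + μ) * c / (2 * L * μ)) ^ 2 := by positivity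
  have h4 : 0 ≤ (L - μ) ^ 2 / (4 * L * μ) * (L ^ 2 * σ ^ 2 - c ^ 2) :=
    mul_nonneg (by positivity) (by linarith)
  linarith

/-- For t ≥ σ this is the previous bound. For t ≤ σ the right side is the convex combination of c²
(weight 1 - t/σ) and of the previous bound's right side at t = σ (weight t/σ). -/
lemma scalar_certificate {L μ σ c t : ℝ} (hμ : 0 < μ) (hL : μ ≤ L) (hσ : 0 < σ)
    (hc0 : 0 ≤ c) (hc : c ≤ L * σ) (ht : 0 ≤ t) :
    L * μ * σ * min t σ * (1 - 1 / 4 * (L / μ - 1) ^ 2) ≤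
      c ^ 2 - (L + μ) * c * t + L * μ * (2 * σ * min t σ - min t σ ^ 2 + t ^ 2) := by
  rcases le_total σ t with h | h
  · rw [min_eq_right h]
    have := scalar_certificate_of_le (t := t) hμ hL hc0 hc
    linarith
  · rw [min_eq_left h]
    have h1 := scalar_certificate_of_le (t := σ) hμ hL hc0 hc
    have h2 := mul_le_mul_of_nonneg_left h1 (div_nonneg ht hσ.le)
    have h3 : 0 ≤ (1 - t / σ) * c ^ 2 :=
      mul_nonneg (by rw [sub_nonneg, div_le_one hσ]; exact h) (sq_nonneg _)
    have h4 : t / σ * (L * μ * σ ^ 2 * (1 - 1 / 4 * (L / μ - 1) ^ 2)) =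
        L * μ * σ * t * (1 - 1 / 4 * (L / μ - 1) ^ 2) := by
      field_simp
    have h5 : (1 - t / σ) * c ^ 2 +
        t / σ * (c ^ 2 - (L + μ) * c * σ + L * μ * (σ ^ 2 + σ ^ 2)) =
        c ^ 2 - (L + μ) * c * t + L * μ * (2 * σ * t - t ^ 2 + t ^ 2) := by
      field_simp
      ring
    linarith

/-! ### From curvature bounds to optimality -/

lemma eq_zero_of_trace_le_zero {n r : ℕ} {E : Matrix (Fin n) (Fin r) ℝ}
    (h : trace (Eᵀ * E) ≤ 0) : E = 0 := by
  rw [trace_transpose_mul_self_eq_sum] at h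
  have h0 : ∀ i ∈ Finset.univ, 0 ≤ ∑ j, E i j ^ 2 := fun i _ =>
    Finset.sum_nonneg fun j _ => sq_nonneg _
  have h1 := (Finset.sum_eq_zero_iff_of_nonneg h0).1 (le_antisymm h (Finset.sum_nonneg h0))
  ext i j
  have h2 := (Finset.sum_eq_zero_iff_of_nonneg fun j _ => sq_nonneg (E i j)).1
    (h1 i (Finset.mem_univ _)) j (Finset.mem_univ _)
  simpa using h2

lemma trace_diagonal_conj {n s : ℕ} (P : Matrix (Fin n) (Fin s) ℝ) (D : Matrix (Fin n) (Fin n) ℝ)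
    (b : Fin s → ℝ) : trace (Dᵀ * (P * diagonal b * Pᵀ)) = ∑ j, b j * (Pᵀ * D * P) j j := by
  have h : trace (Dᵀ * (P * diagonal b * Pᵀ)) = trace (diagonal b * (Pᵀ * D * P)) := by
    rw [← trace_transpose]
    simp only [transpose_mul, transpose_transpose, diagonal_transpose, Matrix.mul_assoc]
    rw [trace_mul_comm P]
    simp only [Matrix.mul_assoc]
  rw [h]
  simp only [trace, diag, diagonal_mul]

/-- The core of the global optimality argument, in a basis in which the factor `Z` of the minimizer
has pairwise orthogonal components outside the range of `Q`. -/
lemma eq_of_curvature_bounds_of_orthogonal {n s d : ℕ} {L μ σ : ℝ} (hμ : 0 < μ) (hL : μ ≤ L)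
    (hσ : 0 < σ) (hK : 1 / 4 * (L / μ - 1) ^ 2 * s < s + d)
    {Q : Matrix (Fin n) (Fin (s + d)) ℝ} (hQ : Qᵀ * Q = 1) {l : Fin (s + d) → ℝ}
    (hl : ∀ k, σ ≤ l k) {Z : Matrix (Fin n) (Fin s) ℝ} {t : Fin s → ℝ} (ht : Monotone t)
    (hZ : Zᵀ * Z - (Qᵀ * Z)ᵀ * (Qᵀ * Z) = diagonal t)
    {G H E : Matrix (Fin n) (Fin n) ℝ} (hE : E = Q * diagonal l * Qᵀ - Z * Zᵀ)
    (hGs : Gᵀ = G) (hG : G * Q = 0)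
    (hcurv : ∀ v, Qᵀ *ᵥ v = 0 → -(L * σ) * (v ⬝ᵥ v) ≤ v ⬝ᵥ G *ᵥ v)
    (hH : ∀ v, 0 ≤ v ⬝ᵥ H *ᵥ v) (hHE : 0 ≤ trace (Hᵀ * E))
    (hco : trace ((G - H)ᵀ * (G - H)) - (L + μ) * trace ((G - H)ᵀ * E) +
      L * μ * trace (Eᵀ * E) ≤ 0) : E = 0 := by
  have hL0 : 0 < L := hμ.trans_le hL
  set C := Qᵀ * Z with hC
  set P := Z - Q * C with hP
  have hQP : Qᵀ * P = 0 := by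
    rw [hP, Matrix.mul_sub, ← Matrix.mul_assoc, hQ, Matrix.one_mul, sub_self]
  have hPQ : Pᵀ * Q = 0 := by
    have := congrArg transpose hQP
    simpa [transpose_mul] using this
  have hPP : Pᵀ * P = diagonal t := by
    rw [← hZ]
    calc Pᵀ * P = Pᵀ * Z - Pᵀ * Q * C := by
          rw [Matrix.mul_assoc, ← Matrix.mul_sub]
      _ = Zᵀ * Z - Cᵀ * C := by
          rw [hPQ, Matrix.zero_mul, sub_zero, hP, transpose_sub, Matrix.sub_mul, transpose_mul,
            Matrix.mul_assoc, hC]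
  set p : Fin s → Fin n → ℝ := fun j => P.col j with hp
  have hpp : ∀ j, p j ⬝ᵥ p j = t j := by
    intro j
    have := congrFun (congrFun hPP j) j
    simpa [mul_apply, dotProduct, hp] using this
  have ht0 : ∀ j, 0 ≤ t j := fun j => by
    rw [← hpp]; exact Finset.sum_nonneg fun i _ => mul_self_nonneg _
  have hQp : ∀ j, Qᵀ *ᵥ p j = 0 := by
    intro j
    ext i
    have := congrFun (congrFun hQP i) j
    simpa [mul_apply, mulVec, dotProduct, hp] using this
  have hform : ∀ (A : Matrix (Fin n) (Fin n) ℝ) j, (Pᵀ * A * P) j j = p j ⬝ᵥ A *ᵥ p j := by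
    intro A j
    rw [Matrix.mul_assoc]
    simp [mul_apply, mulVec, dotProduct, hp]
  set g : Fin s → ℝ := fun j => p j ⬝ᵥ G *ᵥ p j with hg
  -- Negative curvature of G along p_j, normalized. When t_j = 0 also p_j = 0, and division by zero
  -- gives c_j = 0.
  set c : Fin s → ℝ := fun j => max 0 (-g j / t j) with hc
  have hc0 : ∀ j, 0 ≤ c j := fun j => le_max_left _ _
  have hp0 : ∀ j, t j = 0 → p j = 0 := fun j hj => by
    have := hpp j
    rw [hj] at this
    exact dotProduct_self_eq_zero.1 this
  have hcL : ∀ j, c j ≤ L * σ := by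
    intro j
    refine max_le (by positivity) ?_
    have h1 := hcurv (p j) (hQp j)
    rw [hpp] at h1
    refine div_le_of_le_mul₀ (ht0 j) (by positivity) ?_
    linarith
  have hct : ∀ j, -g j ≤ c j * t j := by
    intro j
    rcases (ht0 j).eq_or_lt with h | h
    · have h1 := hp0 j h.symm
      simp [hg, h1, ← h]
    · calc -g j = -g j / t j * t j := by field_simp
        _ ≤ _ := mul_le_mul_of_nonneg_right (le_max_right _ _) h.le
  have hGE : trace ((G - H)ᵀ * E) ≤ ∑ j, c j * t j := by
    have e1 : trace (Gᵀ * E) = -∑ j, g j := by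
      -- G annihilates the range of Q, so only the orthogonal part P of Z contributes to ⟨G, E⟩.
      have e2 : G * Z = G * P := by
        rw [hP, Matrix.mul_sub, ← Matrix.mul_assoc, hG, Matrix.zero_mul, sub_zero]
      have e3 : Zᵀ * G = Pᵀ * G := by
        have := congrArg transpose e2
        rwa [transpose_mul, transpose_mul, hGs] at this
      rw [hGs, hE, Matrix.mul_sub, Matrix.mul_assoc, ← Matrix.mul_assoc, hG, Matrix.zero_mul,
        zero_sub, trace_neg, ← Matrix.mul_assoc, trace_mul_comm, e2, ← Matrix.mul_assoc, e3]
      rw [trace]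
      congr 1
      exact Finset.sum_congr rfl fun j _ => hform G j
    rw [transpose_sub, Matrix.sub_mul, trace_sub, e1]
    have := Finset.sum_le_sum fun j (_ : j ∈ Finset.univ) => hct j
    rw [Finset.sum_neg_distrib] at this
    linarith
  have hDD : ∑ j, c j ^ 2 ≤ trace ((G - H)ᵀ * (G - H)) := by
    -- Duality: ‖D‖² ≥ 2⟨D, Y⟩ - ‖Y‖² for D = G - H, tested on Y = -∑ (c_j / t_j) p_j p_jᵀ. Since H
    -- ⪰ 0 and b ≤ 0, subtracting H only increases ⟨D, Y⟩.
    set b : Fin s → ℝ := fun j => -(c j / t j) with hb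
    set Y := P * diagonal b * Pᵀ with hY
    have e1 : ∀ j, c j ^ 2 ≤ b j * (Pᵀ * (G - H) * P) j j := by
      intro j
      rw [hform, sub_mulVec, dotProduct_sub]
      rcases (ht0 j).eq_or_lt with h | h
      · simp [hb, hc, ← h]
      · have e2 : b j ≤ 0 := neg_nonpos.2 (div_nonneg (hc0 j) h.le)
        have e3 : c j ^ 2 = b j * g j := by
          rcases le_total 0 (-g j / t j) with h' | h'
          · simp only [hc, hb, max_eq_right h']; field_simp
          · simp [hc, hb, max_eq_left h']
        have := mul_nonpos_of_nonpos_of_nonneg e2 (hH (p j))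
        rw [mul_sub, e3]
        change b j * g j ≤ b j * g j - _
        linarith
    have e2 : trace (Yᵀ * Y) ≤ ∑ j, c j ^ 2 := by
      have hYs : Y = Yᵀ := by
        rw [hY]; simp [transpose_mul, Matrix.mul_assoc]
      conv_lhs => enter [1, 2]; rw [hY]
      rw [trace_diagonal_conj]
      have : Pᵀ * Y * P = diagonal t * diagonal b * diagonal t := by
        rw [hY, ← hPP]; simp only [Matrix.mul_assoc]
      rw [this, diagonal_mul_diagonal, diagonal_mul_diagonal]
      refine Finset.sum_le_sum fun j _ => ?_
      rw [diagonal_apply_eq]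
      rcases (ht0 j).eq_or_lt with h | h
      · rw [← h]; simp [sq_nonneg]
      · simp only [hb]
        apply le_of_eq
        field_simp
    have e3 := trace_diagonal_conj P (G - H) b
    have e4 : 0 ≤ trace ((G - H - Y)ᵀ * (G - H - Y)) := by
      rw [trace_transpose_mul_self_eq_sum]; positivity
    have e5 : trace ((G - H - Y)ᵀ * (G - H - Y)) = trace ((G - H)ᵀ * (G - H)) -
        2 * trace ((G - H)ᵀ * Y) + trace (Yᵀ * Y) := by
      generalize G - H = D
      have : trace (Yᵀ * D) = trace (Dᵀ * Y) := by
        rw [← trace_transpose, transpose_mul, transpose_transpose]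
      rw [transpose_sub, Matrix.sub_mul, Matrix.mul_sub, Matrix.mul_sub, trace_sub,
        trace_sub, trace_sub, this]
      ring
    rw [← hY] at e3
    have := Finset.sum_le_sum fun j (_ : j ∈ Finset.univ) => e1 j
    linarith
  have hEE : trace (Eᵀ * E) = trace ((diagonal l - C * Cᵀ)ᵀ * (diagonal l - C * Cᵀ)) +
      2 * trace (C * diagonal t * Cᵀ) + ∑ j, t j ^ 2 := by
    have hZZ : Zᵀ * Z = Cᵀ * C + diagonal t := by rw [← hZ]; abel
    have hEs : Eᵀ = E := by
      rw [hE]; simp [transpose_mul, Matrix.mul_assoc]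
    have hAs : (diagonal l - C * Cᵀ)ᵀ = diagonal l - C * Cᵀ := by
      simp [transpose_mul]
    have a1 : trace (Q * diagonal l * Qᵀ * (Q * diagonal l * Qᵀ)) =
        trace (diagonal l * diagonal l) := by
      rw [trace_mul_comm, show Q * diagonal l * Qᵀ * (Q * diagonal l * Qᵀ) =
        Q * (diagonal l * (Qᵀ * Q) * diagonal l * Qᵀ) by simp only [Matrix.mul_assoc], hQ,
        trace_mul_comm Q, Matrix.mul_one, Matrix.mul_assoc, hQ, Matrix.mul_one]
    have a2 : trace (Q * diagonal l * Qᵀ * (Z * Zᵀ)) = trace (diagonal l * (C * Cᵀ)) := by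
      rw [show Q * diagonal l * Qᵀ * (Z * Zᵀ) = Q * (diagonal l * (Qᵀ * Z) * Zᵀ) by
        simp only [Matrix.mul_assoc], trace_mul_comm Q, hC, transpose_mul, transpose_transpose]
      simp only [Matrix.mul_assoc]
    have a3 : trace (Z * Zᵀ * (Z * Zᵀ)) = trace (C * Cᵀ * (C * Cᵀ)) +
        2 * trace (C * diagonal t * Cᵀ) + ∑ j, t j ^ 2 := by
      have b1 : trace (Z * Zᵀ * (Z * Zᵀ)) = trace ((Zᵀ * Z) * (Zᵀ * Z)) := by
        rw [Matrix.mul_assoc, trace_mul_comm Z]; simp only [Matrix.mul_assoc]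
      have b2 : trace (C * Cᵀ * (C * Cᵀ)) = trace ((Cᵀ * C) * (Cᵀ * C)) := by
        rw [Matrix.mul_assoc, trace_mul_comm C]; simp only [Matrix.mul_assoc]
      have b3 : trace (C * diagonal t * Cᵀ) = trace (Cᵀ * C * diagonal t) := by
        rw [trace_mul_comm, ← Matrix.mul_assoc]
      have b4 : trace (diagonal t * diagonal t) = ∑ j, t j ^ 2 := by
        rw [diagonal_mul_diagonal, trace_diagonal]; simp [sq]
      rw [b1, b2, b3, hZZ, Matrix.add_mul, Matrix.mul_add, Matrix.mul_add, trace_add, trace_add,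
        trace_add, b4, trace_mul_comm (diagonal t)]
      ring
    rw [hEs, hAs, hE, Matrix.sub_mul, Matrix.mul_sub, Matrix.mul_sub, Matrix.sub_mul,
      Matrix.mul_sub, Matrix.mul_sub]
    simp only [trace_sub]
    rw [a1, a3, a2, trace_mul_comm (Z * Zᵀ), a2, trace_mul_comm (C * Cᵀ) (diagonal l)]
    ring
  have hlow := penalized_distance_lower_bound hσ.le hl C ht ht0
  set m : Fin s → ℝ := fun j => min (t j) σ with hm
  have hm0 : ∀ j, 0 ≤ m j := fun j => le_min (ht0 j) hσ.le
  set K := 1 / 4 * (L / μ - 1) ^ 2 with hKdef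
  have hscal := Finset.sum_le_sum fun j (_ : j ∈ Finset.univ) =>
    scalar_certificate hμ hL hσ (hc0 j) (hcL j) (ht0 j)
  have hLμ : 0 < L * μ := by positivity
  have htotal : L * μ * σ * ((1 - K) * ∑ j, m j + d * σ) ≤ 0 := by
    have i1 : ∑ j, (c j ^ 2 - (L + μ) * c j * t j +
        L * μ * (2 * σ * min (t j) σ - min (t j) σ ^ 2 + t j ^ 2)) = ∑ j, c j ^ 2 -
        (L + μ) * ∑ j, c j * t j + L * μ * (∑ j, (2 * σ * min (t j) σ - min (t j) σ ^ 2) +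
          ∑ j, t j ^ 2) := by
      simp only [Finset.sum_add_distrib, Finset.sum_sub_distrib, Finset.mul_sum, mul_assoc,
        mul_add, mul_sub]
    have i2 : ∑ j, L * μ * σ * min (t j) σ * (1 - K) = L * μ * σ * ((1 - K) * ∑ j, m j) := by
      rw [Finset.mul_sum, Finset.mul_sum]
      exact Finset.sum_congr rfl fun j _ => by simp only [hm]; ring
    rw [i1, i2] at hscal
    have i3 := mul_le_mul_of_nonneg_left hGE (by linarith : 0 ≤ L + μ)
    have i4 := mul_le_mul_of_nonneg_left hlow hLμ.le
    rw [hEE] at hco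
    linarith
  have htot : (1 - K) * ∑ j, m j + d * σ ≤ 0 := by
    by_contra h
    push Not at h
    have : 0 < L * μ * σ * ((1 - K) * ∑ j, m j + d * σ) := by positivity
    linarith
  have hmσ : ∑ j, m j ≤ s * σ := by
    calc ∑ j, m j ≤ ∑ _j : Fin s, σ := Finset.sum_le_sum fun j _ => min_le_right _ _
      _ = _ := by simp
  have hK1 : K < 1 := by
    by_contra h
    push Not at h
    -- If K ≥ 1, replacing each m_j by its maximum σ lowers the left side of `htot` to (s + d - K
    -- s)σ, which is still positive.
    have h1 : (1 - K) * (s * σ) ≤ (1 - K) * ∑ j, m j :=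
      mul_le_mul_of_nonpos_left hmσ (by linarith)
    have h2 : 0 < (s + d - K * s) * σ := mul_pos (by linarith) hσ
    linarith
  have hms : ∑ j, m j ≤ 0 := by
    have : 0 ≤ (d : ℝ) * σ := by positivity
    by_contra h
    push Not at h
    have := mul_pos (sub_pos.2 hK1) h
    linarith
  have hm_zero : ∀ j, m j = 0 := fun j =>
    (Finset.sum_eq_zero_iff_of_nonneg fun j _ => hm0 j).1
      (le_antisymm hms (Finset.sum_nonneg fun j _ => hm0 j)) j (Finset.mem_univ _)
  have htz : ∀ j, t j = 0 := by
    intro j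
    by_contra h
    have : 0 < t j := lt_of_le_of_ne (ht0 j) (Ne.symm h)
    exact (lt_min this hσ).ne' (hm_zero j)
  have hGE0 : trace ((G - H)ᵀ * E) ≤ 0 := by
    refine hGE.trans (le_of_eq ?_)
    simp [htz]
  apply eq_zero_of_trace_le_zero
  have h1 : 0 ≤ trace ((G - H)ᵀ * (G - H)) := by
    rw [trace_transpose_mul_self_eq_sum]; positivity
  have h2 : (L + μ) * trace ((G - H)ᵀ * E) ≤ 0 :=
    mul_nonpos_of_nonneg_of_nonpos (by linarith) hGE0
  by_contra h
  push Not at h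
  have := mul_pos hLμ h
  linarith

/-- Z matters only through ZZᵀ, so it may be replaced by ZW, with W orthogonal diagonalizing the
Gram matrix of its part outside the range of Q, eigenvalues in increasing order. -/
lemma eq_of_curvature_bounds {n s d : ℕ} {L μ σ : ℝ} (hμ : 0 < μ) (hL : μ ≤ L)
    (hσ : 0 < σ) (hK : 1 / 4 * (L / μ - 1) ^ 2 * s < s + d)
    {Q : Matrix (Fin n) (Fin (s + d)) ℝ} (hQ : Qᵀ * Q = 1) {l : Fin (s + d) → ℝ}
    (hl : ∀ k, σ ≤ l k) {Z : Matrix (Fin n) (Fin s) ℝ}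
    {G H E : Matrix (Fin n) (Fin n) ℝ} (hE : E = Q * diagonal l * Qᵀ - Z * Zᵀ)
    (hGs : Gᵀ = G) (hG : G * Q = 0)
    (hcurv : ∀ v, Qᵀ *ᵥ v = 0 → -(L * σ) * (v ⬝ᵥ v) ≤ v ⬝ᵥ G *ᵥ v)
    (hH : ∀ v, 0 ≤ v ⬝ᵥ H *ᵥ v) (hHE : 0 ≤ trace (Hᵀ * E))
    (hco : trace ((G - H)ᵀ * (G - H)) - (L + μ) * trace ((G - H)ᵀ * E) +
      L * μ * trace (Eᵀ * E) ≤ 0) : E = 0 := by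
  obtain ⟨W, t, hW, ht, hWt⟩ := exists_orthogonal_diagonal
    (Zᵀ * Z - (Qᵀ * Z)ᵀ * (Qᵀ * Z)) (by simp [IsSymm, transpose_mul, transpose_sub])
  have hW' : W * Wᵀ = 1 := mul_eq_one_comm.1 hW
  refine eq_of_curvature_bounds_of_orthogonal (Z := Z * W) hμ hL hσ hK hQ hl ht ?_ ?_ hGs hG hcurv
    hH hHE hco
  · rw [← hWt]
    simp only [transpose_mul, transpose_transpose, Matrix.mul_assoc, Matrix.mul_sub,
      Matrix.sub_mul]
  · rw [hE, transpose_mul, Matrix.mul_assoc Z, ← Matrix.mul_assoc W, hW', Matrix.one_mul]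

/-- Either `X Xᵀ = Z Zᵀ` or the gradient `G` at `X Xᵀ` is positive semidefinite. -/
lemma eq_or_gradient_nonneg {n r s : ℕ} {L μ : ℝ} (hμ : 0 < μ) (hL : μ ≤ L) (hs : s ≤ r)
    (hK : 1 / 4 * (L / μ - 1) ^ 2 * s < r)
    {X : Matrix (Fin n) (Fin r) ℝ} {Z : Matrix (Fin n) (Fin s) ℝ}
    {G H : Matrix (Fin n) (Fin n) ℝ} (hGs : Gᵀ = G) (hG : G * X = 0)
    (hcurv : ∀ (v : Fin n → ℝ) (w : Fin r → ℝ), 0 ≤ (w ⬝ᵥ w) * (v ⬝ᵥ G *ᵥ v) +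
      L * ((X *ᵥ w ⬝ᵥ X *ᵥ w) * (v ⬝ᵥ v) + (X *ᵥ w ⬝ᵥ v) ^ 2))
    (hH : ∀ v, 0 ≤ v ⬝ᵥ H *ᵥ v) (hHE : 0 ≤ trace (Hᵀ * (X * Xᵀ - Z * Zᵀ)))
    (hco : trace ((G - H)ᵀ * (G - H)) - (L + μ) * trace ((G - H)ᵀ * (X * Xᵀ - Z * Zᵀ)) +
      L * μ * trace ((X * Xᵀ - Z * Zᵀ)ᵀ * (X * Xᵀ - Z * Zᵀ)) ≤ 0) :
    X * Xᵀ = Z * Zᵀ ∨ ∀ v, 0 ≤ v ⬝ᵥ G *ᵥ v := by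
  obtain ⟨d, rfl⟩ := Nat.exists_eq_add_of_le hs
  have hr : 0 < s + d := by
    rcases Nat.eq_zero_or_pos (s + d) with h | h
    · rw [h] at hK
      have : 0 ≤ 1 / 4 * (L / μ - 1) ^ 2 * (s : ℝ) := by positivity
      norm_num at hK
      linarith
    · exact h
  obtain ⟨U, l, hU, hl, hUl⟩ := exists_orthogonal_diagonal (Xᵀ * X)
    (by simp [IsSymm, transpose_mul])
  have hU' : U * Uᵀ = 1 := mul_eq_one_comm.1 hU
  set Y := X * U with hY
  have hYY : Yᵀ * Y = diagonal l := by
    rw [← hUl, hY]; simp only [transpose_mul, Matrix.mul_assoc]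
  have hYX : Y * Yᵀ = X * Xᵀ := by
    rw [hY, transpose_mul, Matrix.mul_assoc X, ← Matrix.mul_assoc U, hU', Matrix.one_mul]
  have hlk : ∀ k, Y.col k ⬝ᵥ Y.col k = l k := fun k => by
    have := congrFun (congrFun hYY k) k
    simpa [mul_apply, dotProduct] using this
  have hl0 : ∀ k, 0 ≤ l k := fun k => by
    rw [← hlk]; exact Finset.sum_nonneg fun i _ => mul_self_nonneg _
  -- Eigenvalues are sorted increasingly, so index 0 carries σ, the least eigenvalue of XᵀX.
  set k₀ : Fin (s + d) := ⟨0, hr⟩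
  have hcurv' : ∀ v : Fin n → ℝ, 0 ≤ v ⬝ᵥ G *ᵥ v + L * (l k₀ * (v ⬝ᵥ v) +
      (Y.col k₀ ⬝ᵥ v) ^ 2) := by
    intro v
    have h1 : U.col k₀ ⬝ᵥ U.col k₀ = 1 := by
      have := congrFun (congrFun hU k₀) k₀
      simpa [mul_apply, dotProduct] using this
    have h2 : X *ᵥ U.col k₀ = Y.col k₀ := by
      ext i; simp [hY, mul_apply, mulVec, dotProduct]
    have := hcurv v (U.col k₀)
    rwa [h1, h2, hlk, one_mul] at this
  rcases (hl0 k₀).eq_or_lt with h0 | hσ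
  · right
    intro v
    have h1 : Y.col k₀ = 0 := dotProduct_self_eq_zero.1 (by rw [hlk, ← h0])
    have := hcurv' v
    rw [h1, ← h0] at this
    simpa using this
  · left
    have hlσ : ∀ k, l k₀ ≤ l k := fun k => hl (by rw [Fin.le_def]; exact Nat.zero_le _)
    have hlpos : ∀ k, 0 < l k := fun k => hσ.trans_le (hlσ k)
    -- Normalized left singular vectors: an orthonormal basis of the column space of X.
    set Q := Y * diagonal (fun k => (√(l k))⁻¹) with hQ
    have hQQ : Qᵀ * Q = 1 := by
      have : Qᵀ * Q = diagonal (fun k => (√(l k))⁻¹) * (Yᵀ * Y) *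
          diagonal (fun k => (√(l k))⁻¹) := by
        rw [hQ]; simp only [transpose_mul, diagonal_transpose, Matrix.mul_assoc]
      rw [this, hYY, diagonal_mul_diagonal, diagonal_mul_diagonal, ← diagonal_one]
      congr 1
      ext k
      have := Real.mul_self_sqrt (hl0 k)
      have h' := Real.sqrt_pos.2 (hlpos k)
      field_simp
      linarith
    have hQX : Q * diagonal l * Qᵀ = X * Xᵀ := by
      have : Q * diagonal l * Qᵀ = Y * (diagonal (fun k => (√(l k))⁻¹) * diagonal l *
          diagonal (fun k => (√(l k))⁻¹)) * Yᵀ := by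
        rw [hQ]; simp only [transpose_mul, diagonal_transpose, Matrix.mul_assoc]
      rw [this, diagonal_mul_diagonal, diagonal_mul_diagonal, ← hYX]
      have : (fun k => (√(l k))⁻¹ * l k * (√(l k))⁻¹) = 1 := by
        ext k
        have := Real.mul_self_sqrt (hl0 k)
        have h' := Real.sqrt_pos.2 (hlpos k)
        simp only [Pi.one_apply]
        field_simp
        linarith
      rw [this]
      change Y * diagonal (fun _ => 1) * Yᵀ = _
      rw [diagonal_one, Matrix.mul_one]
    have hE : X * Xᵀ - Z * Zᵀ = 0 := by
      refine eq_of_curvature_bounds (d := d) hμ hL hσ (by push_cast at hK; exact hK) hQQ hlσ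
        (by rw [hQX]) hGs ?_ ?_ hH hHE hco
      · rw [hQ, hY, ← Matrix.mul_assoc, ← Matrix.mul_assoc, hG, Matrix.zero_mul, Matrix.zero_mul]
      · intro v hv
        have h1 := hcurv' v
        have h2 : Y.col k₀ ⬝ᵥ v = 0 := by
          have h3 := congrFun hv k₀
          have h4 : (√(l k₀))⁻¹ * (Y.col k₀ ⬝ᵥ v) = 0 := by
            refine Eq.trans ?_ h3
            simp only [hQ, mulVec, dotProduct, transpose_apply, mul_diagonal, Finset.mul_sum, col]
            exact Finset.sum_congr rfl fun i _ => by ring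
          exact (mul_eq_zero.1 h4).resolve_left (inv_pos.2 (Real.sqrt_pos.2 hσ)).ne'
        rw [h2] at h1
        linarith
    exact sub_eq_zero.1 hE

/-! ### Calculus for twice differentiable functions -/

section Calculus

variable {S : Type*} [NormedAddCommGroup S] [NormedSpace ℝ S]

lemma hasDerivAt_line {F : Type*} [NormedAddCommGroup F] [NormedSpace ℝ F] {f : S → F}
    (hf : Differentiable ℝ f) (x v : S) (s : ℝ) :
    HasDerivAt (fun s : ℝ => f (x + s • v)) (fderiv ℝ f (x + s • v) v) s := by
  have h : HasDerivAt (fun s : ℝ => x + s • v) v s := by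
    simpa using ((hasDerivAt_id s).smul_const v).const_add x
  exact (hf _).hasFDerivAt.comp_hasDerivAt s h

lemma exists_fderiv_eq_sub {f : S → ℝ} (hf : Differentiable ℝ f) (x v : S) :
    ∃ s ∈ Set.Ioo (0 : ℝ) 1, fderiv ℝ f (x + s • v) v = f (x + v) - f x := by
  obtain ⟨s, hs, h⟩ := exists_hasDerivAt_eq_slope (fun s : ℝ => f (x + s • v))
    (fun s => fderiv ℝ f (x + s • v) v) zero_lt_one
    (fun s _ => (hasDerivAt_line hf x v s).continuousAt.continuousWithinAt)
    (fun s _ => hasDerivAt_line hf x v s)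
  exact ⟨s, hs, by simpa using h⟩

lemma hasDerivAt_fderiv_line {f : S → ℝ} (hf : Differentiable ℝ (fderiv ℝ f)) (x v w : S) (s : ℝ) :
    HasDerivAt (fun s : ℝ => fderiv ℝ f (x + s • v) w)
      (fderiv ℝ (fderiv ℝ f) (x + s • v) v w) s := by
  simpa using (hasDerivAt_line hf x v s).clm_apply (hasDerivAt_const s w)

lemma exists_second_fderiv_eq_sub {f : S → ℝ} (hf : Differentiable ℝ (fderiv ℝ f)) (x v w : S) :
    ∃ s ∈ Set.Ioo (0 : ℝ) 1,
      fderiv ℝ (fderiv ℝ f) (x + s • v) v w = fderiv ℝ f (x + v) w - fderiv ℝ f x w := by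
  have hd := hasDerivAt_fderiv_line hf x v w
  obtain ⟨s, hs, h⟩ := exists_hasDerivAt_eq_slope (fun s : ℝ => fderiv ℝ f (x + s • v) w)
    (fun s => fderiv ℝ (fderiv ℝ f) (x + s • v) v w) zero_lt_one
    (fun s _ => (hd s).continuousAt.continuousWithinAt) (fun s _ => hd s)
  exact ⟨s, hs, by simpa using h⟩

namespace SmoothStronglyConvex

variable {L μ : ℝ} {φ : S → ℝ}

lemma le_of_nontrivial [Nontrivial S] (h : SmoothStronglyConvex L μ φ) : μ ≤ L := by
  obtain ⟨E, hE⟩ := exists_ne (0 : S)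
  have h1 := (h.strongly_convex 0 E).trans (h.smooth 0 E)
  exact le_of_mul_le_mul_right h1 (by positivity)

lemma fderiv_lt_sub (h : SmoothStronglyConvex L μ φ) {M N : S} (hMN : N ≠ M) :
    fderiv ℝ φ M (N - M) < φ N - φ M := by
  have hE : 0 < ‖N - M‖ := norm_pos_iff.2 (sub_ne_zero.2 hMN)
  obtain ⟨s, hs, h1⟩ := exists_fderiv_eq_sub h.differentiable M (N - M)
  obtain ⟨s', -, h2⟩ := exists_second_fderiv_eq_sub h.differentiable_fderiv M (s • (N - M))
    (s • (N - M))
  have h3 := h.strongly_convex (M + s' • s • (N - M)) (s • (N - M))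
  have h4 : 0 < μ * ‖s • (N - M)‖ ^ 2 := by
    have := h.pos
    have : 0 < ‖s • (N - M)‖ := norm_pos_iff.2 (smul_ne_zero hs.1.ne' (sub_ne_zero.2 hMN))
    positivity
  rw [h2, map_smul, map_smul, h1, ← smul_sub, smul_eq_mul] at h3
  rw [add_sub_cancel] at h3
  have := pos_of_mul_pos_right (h4.trans_le h3) hs.1.le
  linarith

lemma fderiv_le_sub (h : SmoothStronglyConvex L μ φ) (M N : S) :
    fderiv ℝ φ M (N - M) ≤ φ N - φ M := by
  rcases eq_or_ne N M with rfl | hne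
  · simp
  · exact (h.fderiv_lt_sub hne).le

end SmoothStronglyConvex

/-- Continuity of the second derivative is not available. A negative second derivative along a line
would make x a local maximum there as well as a minimum; the function is then locally constant on
the line and its second derivative vanishes. -/
lemma isSecondOrderPoint_of_forall_le {f : S → ℝ} (hf : Differentiable ℝ f)
    (hf' : Differentiable ℝ (fderiv ℝ f)) {x : S} (hx : ∀ y, f x ≤ f y) :
    IsSecondOrderPoint f x := by
  refine ⟨IsLocalMin.fderiv_eq_zero (Eventually.of_forall hx), fun v => ?_⟩
  by_contra! hneg
  have h1 : deriv (fun s : ℝ => f (x + s • v)) = fun s => fderiv ℝ f (x + s • v) v := by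
    ext s; exact (hasDerivAt_line hf x v s).deriv
  have h2 : deriv (deriv (fun s : ℝ => f (x + s • v))) 0 = fderiv ℝ (fderiv ℝ f) x v v := by
    rw [h1, (hasDerivAt_fderiv_line hf' x v v 0).deriv]
    simp
  have h3 : IsLocalMax (fun s : ℝ => f (x + s • v)) 0 := by
    refine isLocalMax_of_deriv_deriv_neg (h2 ▸ hneg) ?_
      (hasDerivAt_line hf x v 0).continuousAt
    simp only [h1]
    rw [IsLocalMin.fderiv_eq_zero (a := x + (0 : ℝ) • v)]
    · simp
    · exact Eventually.of_forall (by simpa using hx)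
  have h4 : (fun s : ℝ => f (x + s • v)) =ᶠ[𝓝 0] fun _ => f x := by
    filter_upwards [h3] with s hs
    exact le_antisymm (by simpa using hs) (hx _)
  have h5 := h4.deriv.deriv_eq
  rw [h2] at h5
  simp at h5
  linarith

end Calculus

/-- With a = (L + μ)/2 and b = (L - μ)/2 the claim is ‖D - aE‖ ≤ b‖E‖. Averaging the Hessian would
need integrability; instead the mean value theorem, applied to the derivative in the single
direction W = D - aE, gives one Hessian B with B(E, W) = ⟨D, W⟩. -/
lemma SmoothStronglyConvex.gradient_difference_bound {S : Type*} [NormedAddCommGroup S]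
    [InnerProductSpace ℝ S] {L μ : ℝ} {φ : S → ℝ} (h : SmoothStronglyConvex L μ φ) (hL : μ ≤ L)
    {M N D : S} (hD : ∀ W, fderiv ℝ φ M W - fderiv ℝ φ N W = inner ℝ D W) :
    ‖D‖ ^ 2 - (L + μ) * inner ℝ D (M - N) + L * μ * ‖M - N‖ ^ 2 ≤ 0 := by
  set E := M - N with hE
  set a := (L + μ) / 2 with ha
  set b := (L - μ) / 2 with hb
  have hb0 : 0 ≤ b := by rw [hb]; linarith
  set W := D - a • E with hW
  obtain ⟨s, -, hs⟩ := exists_second_fderiv_eq_sub h.differentiable_fderiv N E W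
  rw [hE, add_sub_cancel, hD, ← hE] at hs
  have hsymm := second_derivative_symmetric (𝕜 := ℝ)
    (fun y => (h.differentiable y).hasFDerivAt)
    (h.differentiable_fderiv (N + s • E)).hasFDerivAt
  have hlow := h.strongly_convex (N + s • E)
  have hup := h.smooth (N + s • E)
  set B := fderiv ℝ (fderiv ℝ φ) (N + s • E)
  have hEW : inner ℝ D W = a * inner ℝ E W + ‖W‖ ^ 2 := by
    have : D = W + a • E := by rw [hW]; abel
    conv_lhs => rw [this]
    rw [inner_add_left, real_inner_smul_left, real_inner_self_eq_norm_sq]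
    ring
  have hWn : ‖W‖ ^ 2 = ‖D‖ ^ 2 - (L + μ) * inner ℝ D E + a ^ 2 * ‖E‖ ^ 2 := by
    rw [hW, norm_sub_sq_real, real_inner_smul_right, norm_smul, mul_pow, Real.norm_eq_abs, sq_abs,
      ha]
    ring
  have hplus : ∀ c : ℝ, B (c • E + W) (c • E + W) = c ^ 2 * B E E + 2 * c * B E W + B W W := by
    intro c
    simp only [map_add, map_smul, _root_.add_apply, _root_.smul_apply,
      smul_eq_mul, hsymm W E]
    ring
  have hnorm : ∀ c : ℝ, ‖c • E + W‖ ^ 2 = c ^ 2 * ‖E‖ ^ 2 + 2 * c * inner ℝ E W + ‖W‖ ^ 2 := by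
    intro c
    rw [norm_add_sq_real, real_inner_smul_left, norm_smul, mul_pow, Real.norm_eq_abs, sq_abs]
    ring
  -- Polarization: subtract the lower bound at -cE + W from the upper bound at cE + W. The choice c
  -- = b below is the one that yields ‖W‖ ≤ b‖E‖.
  have key : ∀ c : ℝ, 0 ≤ c → 2 * c * ‖W‖ ^ 2 ≤ b * (c ^ 2 * ‖E‖ ^ 2 + ‖W‖ ^ 2) := by
    intro c hc
    have h1 := hup (c • E + W)
    have h2 := hlow (-c • E + W)
    rw [hplus, hnorm] at h1 h2
    rw [← hs] at hEW
    have ea : L = a + b := by rw [ha, hb]; ring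
    have eb : μ = a - b := by rw [ha, hb]; ring
    rw [hEW, ea] at h1
    rw [hEW, eb] at h2
    nlinarith
  have hfin : ‖W‖ ^ 2 ≤ b ^ 2 * ‖E‖ ^ 2 := by
    rcases hb0.eq_or_lt with h0 | hpos
    · have := key 1 zero_le_one
      rw [← h0] at this ⊢
      nlinarith
    · have := key b hb0
      have h2 : b * ‖W‖ ^ 2 ≤ b * (b ^ 2 * ‖E‖ ^ 2) := by nlinarith
      exact le_of_mul_le_mul_left h2 hpos
  have : a ^ 2 - b ^ 2 = L * μ := by rw [ha, hb]; ring
  nlinarith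

/-! ### The trace inner product and the factorization M = UUᵀ -/

namespace SymMatrix

variable {n : ℕ}

lemma isSymm (M : SymMatrix n) : M.1ᵀ = M.1 := M.2

lemma norm_sq (M : SymMatrix n) : ‖M‖ ^ 2 = trace (M.1ᵀ * M.1) := by
  change ‖M.1‖ ^ 2 = _
  rw [trace_transpose_mul_self_eq_sum, frobenius_norm_def, ← Real.sqrt_eq_rpow,
    Real.sq_sqrt (by positivity)]
  simp

@[simp] lemma add_val (M N : SymMatrix n) : (M + N).1 = M.1 + N.1 := rfl
@[simp] lemma sub_val (M N : SymMatrix n) : (M - N).1 = M.1 - N.1 := rfl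
@[simp] lemma smul_val (c : ℝ) (M : SymMatrix n) : (c • M).1 = c • M.1 := rfl
@[simp] lemma zero_val : (0 : SymMatrix n).1 = 0 := rfl

/-- The trace inner product on symmetric matrices. -/
noncomputable abbrev innerProductSpace (n : ℕ) : InnerProductSpace ℝ (SymMatrix n) where
  inner M N := trace (M.1ᵀ * N.1)
  norm_sq_eq_re_inner M := norm_sq M
  conj_inner_symm M N := by
    change trace (N.1ᵀ * M.1) = trace (M.1ᵀ * N.1)
    rw [← trace_transpose, transpose_mul, transpose_transpose]
  add_left M N P := by
    change trace ((M + N).1ᵀ * P.1) = trace (M.1ᵀ * P.1) + trace (N.1ᵀ * P.1)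
    rw [add_val, transpose_add, Matrix.add_mul, trace_add]
  smul_left M N c := by
    change trace ((c • M).1ᵀ * N.1) = c * trace (M.1ᵀ * N.1)
    rw [smul_val, transpose_smul, Matrix.smul_mul, trace_smul, smul_eq_mul]

noncomputable instance (n : ℕ) : FiniteDimensional ℝ (SymMatrix n) :=
  inferInstanceAs (FiniteDimensional ℝ (symSubmodule n))

end SymMatrix

attribute [local instance] SymMatrix.innerProductSpace

lemma SymMatrix.inner_eq {n : ℕ} (M N : SymMatrix n) : inner ℝ M N = trace (M.1ᵀ * N.1) := rfl

lemma SymMatrix.exists_gradient {n : ℕ} (g : SymMatrix n →L[ℝ] ℝ) :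
    ∃ G : SymMatrix n, ∀ W, g W = inner ℝ G W := by
  have : CompleteSpace (SymMatrix n) := FiniteDimensional.complete ℝ _
  exact ⟨(InnerProductSpace.toDual ℝ (SymMatrix n)).symm g, fun W => by simp⟩

lemma SymMatrix.ext {n : ℕ} {M N : SymMatrix n} (h : M.1 = N.1) : M = N := Subtype.ext h

section Factorization

variable {S W : Type*} [NormedAddCommGroup S] [NormedSpace ℝ S] [NormedAddCommGroup W]
  [NormedSpace ℝ W]

lemma hasFDerivAt_of_bilinear {b : W →L[ℝ] W →L[ℝ] S} (hb : ∀ X V, b X V = b V X)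
    {o : W → S} (ho : ∀ X, b X X = (2 : ℝ) • o X) (X : W) : HasFDerivAt o (b X) X := by
  have h1 : o = fun X => (1 / 2 : ℝ) • b X X := by
    ext1 Y
    rw [ho, smul_smul]
    norm_num
  have h2 := ((b.hasFDerivAt (x := X)).clm_apply (hasFDerivAt_id X)).const_smul (1 / 2 : ℝ)
  rw [h1]
  refine h2.congr_fderiv ?_
  ext1 V
  simp only [ContinuousLinearMap.flip_apply, _root_.smul_apply, _root_.add_apply,
    ContinuousLinearMap.comp_apply, ContinuousLinearMap.id_apply, id]
  rw [hb V X, ← two_smul ℝ (b X V), smul_smul]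
  norm_num

/-- First and second derivatives of `φ ∘ o` for a quadratic map `o` with polarization `b`. -/
lemma derivatives_comp_quadratic [FiniteDimensional ℝ W] [FiniteDimensional ℝ S]
    {b : W →ₗ[ℝ] W →ₗ[ℝ] S} (hb : ∀ X V, b X V = b V X)
    {o : W → S} (ho : ∀ X, b X X = (2 : ℝ) • o X) {φ : S → ℝ} (hφ : Differentiable ℝ φ)
    (hφ' : Differentiable ℝ (fderiv ℝ φ)) :
    Differentiable ℝ (fun X => φ (o X)) ∧ Differentiable ℝ (fderiv ℝ fun X => φ (o X)) ∧
      ∀ X, IsSecondOrderPoint (fun X => φ (o X)) X ↔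
        (∀ V, fderiv ℝ φ (o X) (b X V) = 0) ∧
        ∀ V, 0 ≤ 2 * fderiv ℝ φ (o X) (o V) +
          fderiv ℝ (fderiv ℝ φ) (o X) (b X V) (b X V) := by
  set β := b.toContinuousBilinearMap
  have hβ : ∀ X V, β X V = b X V := fun X V => rfl
  have ho' := hasFDerivAt_of_bilinear (b := β) hb ho
  have h0 : ∀ X, HasFDerivAt (fun X => φ (o X)) ((fderiv ℝ φ (o X)).comp (β X)) X := fun X =>
    (hφ _).hasFDerivAt.comp X (ho' X)
  have h1 : fderiv ℝ (fun X => φ (o X)) = fun X => (fderiv ℝ φ (o X)).comp (β X) :=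
    funext fun X => (h0 X).fderiv
  have h2 := fun X => ((hφ' (o X)).hasFDerivAt.comp X (ho' X)).clm_comp (β.hasFDerivAt (x := X))
  refine ⟨fun X => (h0 X).differentiableAt, h1 ▸ fun X => (h2 X).differentiableAt, fun X => ?_⟩
  rw [IsSecondOrderPoint, (h0 X).fderiv, h1]
  have h3 := (h2 X).fderiv
  simp only [Function.comp_def] at h3
  rw [h3, ContinuousLinearMap.ext_iff]
  refine and_congr Iff.rfl (forall_congr' fun V => ?_)
  simp only [_root_.add_apply, ContinuousLinearMap.comp_apply, ContinuousLinearMap.compL_apply,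
    ContinuousLinearMap.flip_apply, hβ, ho, map_smul, smul_eq_mul]

end Factorization

/-- The symmetric product `X Vᵀ + V Xᵀ`. -/
def symProd {n r : ℕ} (X V : Matrix (Fin n) (Fin r) ℝ) : SymMatrix n :=
  ⟨X * Vᵀ + V * Xᵀ, by simp [symSubmodule, IsSymm, transpose_add, transpose_mul, add_comm]⟩

lemma symProd_val {n r : ℕ} (X V : Matrix (Fin n) (Fin r) ℝ) :
    (symProd X V).1 = X * Vᵀ + V * Xᵀ := rfl

lemma outer_val {n r : ℕ} (X : Matrix (Fin n) (Fin r) ℝ) : (outer X).1 = X * Xᵀ := rfl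

lemma symProd_self {n r : ℕ} (X : Matrix (Fin n) (Fin r) ℝ) :
    symProd X X = (2 : ℝ) • outer X :=
  SymMatrix.ext (by rw [SymMatrix.smul_val, symProd_val, outer_val, two_smul])

lemma symProd_comm {n r : ℕ} (X V : Matrix (Fin n) (Fin r) ℝ) : symProd X V = symProd V X :=
  SymMatrix.ext (by rw [symProd_val, symProd_val, add_comm])

lemma symProd_add_right {n r : ℕ} (X V W : Matrix (Fin n) (Fin r) ℝ) :
    symProd X (V + W) = symProd X V + symProd X W :=
  SymMatrix.ext (by
    simp only [SymMatrix.add_val, symProd_val, transpose_add, Matrix.mul_add, Matrix.add_mul]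
    abel)

lemma symProd_smul_right {n r : ℕ} (c : ℝ) (X V : Matrix (Fin n) (Fin r) ℝ) :
    symProd X (c • V) = c • symProd X V :=
  SymMatrix.ext (by
    simp only [SymMatrix.smul_val, symProd_val, transpose_smul, Matrix.mul_smul, Matrix.smul_mul,
      smul_add])

/-- The symmetric product as a bilinear map. -/
noncomputable def symProdBilin (n r : ℕ) :
    Matrix (Fin n) (Fin r) ℝ →ₗ[ℝ] Matrix (Fin n) (Fin r) ℝ →ₗ[ℝ] SymMatrix n :=
  LinearMap.mk₂ ℝ (symProd (n := n) (r := r))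
    (fun X Y V => by simp only [symProd_comm _ V, symProd_add_right])
    (fun c X V => by simp only [symProd_comm _ V, symProd_smul_right])
    symProd_add_right symProd_smul_right

section

variable {n r : ℕ} {φ : SymMatrix n → ℝ}

lemma derivatives_bm (hφ : Differentiable ℝ φ) (hφ' : Differentiable ℝ (fderiv ℝ φ)) :
    Differentiable ℝ (bm r φ) ∧ Differentiable ℝ (fderiv ℝ (bm r φ)) ∧
      ∀ X : Matrix (Fin n) (Fin r) ℝ, IsSecondOrderPoint (bm r φ) X ↔
        (∀ V : Matrix (Fin n) (Fin r) ℝ, fderiv ℝ φ (outer X) (symProd X V) = 0) ∧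
        ∀ V : Matrix (Fin n) (Fin r) ℝ, 0 ≤ 2 * fderiv ℝ φ (outer X) (outer V) +
          fderiv ℝ (fderiv ℝ φ) (outer X) (symProd X V) (symProd X V) :=
  derivatives_comp_quadratic (b := symProdBilin n r) symProd_comm symProd_self hφ hφ'

lemma isSecondOrderPoint_bm_of_forall_le (hφ : Differentiable ℝ φ)
    (hφ' : Differentiable ℝ (fderiv ℝ φ)) {X : Matrix (Fin n) (Fin r) ℝ}
    (hX : ∀ U, bm r φ X ≤ bm r φ U) : IsSecondOrderPoint (bm r φ) X :=
  have h := derivatives_bm (r := r) hφ hφ'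
  isSecondOrderPoint_of_forall_le h.1 h.2.1 hX

lemma posSemidef_outer (U : Matrix (Fin n) (Fin r) ℝ) : (outer U).1.PosSemidef := by
  have := posSemidef_self_mul_conjTranspose U
  rwa [conjTranspose_eq_transpose_of_trivial] at this

lemma IsPSDMinimizer.fderiv_nonneg {M : SymMatrix n} (hM : IsPSDMinimizer φ M)
    (hφ : Differentiable ℝ φ) {N : SymMatrix n} (hN : N.1.PosSemidef) :
    0 ≤ fderiv ℝ φ M (N - M) := by
  have hmin : IsLocalMinOn φ {P | P.1.PosSemidef} M :=
    (isMinOn_iff.2 fun P hP => hM.2 P hP).localize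
  refine hmin.hasFDerivWithinAt_nonneg (hφ M).hasFDerivAt.hasFDerivWithinAt
    (sub_mem_posTangentConeAt_of_segment_subset ?_)
  rintro _ ⟨a, b, ha, hb, -, rfl⟩
  exact (hM.1.smul ha).add (hN.smul hb)

lemma IsPSDMinimizer.eq {L μ : ℝ} {M N : SymMatrix n} (hM : IsPSDMinimizer φ M)
    (hφ : SmoothStronglyConvex L μ φ) (hN : N.1.PosSemidef) (hle : φ N ≤ φ M) : N = M := by
  by_contra hne
  have h1 := hφ.fderiv_lt_sub hne
  have h2 := hM.fderiv_nonneg hφ.differentiable hN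
  linarith

lemma inner_outer (G : SymMatrix n) (V : Matrix (Fin n) (Fin r) ℝ) :
    inner ℝ G (outer V) = trace (Vᵀ * G.1 * V) := by
  rw [SymMatrix.inner_eq, G.isSymm, outer_val, ← Matrix.mul_assoc, trace_mul_comm, ← Matrix.mul_assoc]

lemma inner_symProd (G : SymMatrix n) (X V : Matrix (Fin n) (Fin r) ℝ) :
    inner ℝ G (symProd X V) = 2 * trace ((G.1 * X)ᵀ * V) := by
  have h1 : trace (G.1 * (X * Vᵀ)) = trace (Xᵀ * G.1 * V) := by
    rw [← trace_transpose, transpose_mul, transpose_mul, transpose_transpose, G.isSymm,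
      Matrix.mul_assoc, trace_mul_comm]
  have h2 : trace (G.1 * (V * Xᵀ)) = trace (Xᵀ * G.1 * V) := by
    rw [← Matrix.mul_assoc, trace_mul_comm, Matrix.mul_assoc]
  rw [SymMatrix.inner_eq, G.isSymm, symProd_val, Matrix.mul_add, trace_add, h1, h2, transpose_mul,
    G.isSymm]
  ring

lemma inner_outer_replicateCol (G : SymMatrix n) (v : Fin n → ℝ) :
    inner ℝ G (outer (replicateCol (Fin 1) v)) = v ⬝ᵥ G.1 *ᵥ v := by
  rw [inner_outer, trace_fin_one, Matrix.mul_assoc]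
  simp [mul_apply, mulVec, dotProduct]

lemma inner_outer_vecMulVec (G : SymMatrix n) (v : Fin n → ℝ) (w : Fin r → ℝ) :
    inner ℝ G (outer (vecMulVec v w)) = (w ⬝ᵥ w) * (v ⬝ᵥ G.1 *ᵥ v) := by
  rw [SymMatrix.inner_eq, G.isSymm, outer_val, transpose_vecMulVec, vecMulVec_mul_vecMulVec,
    mul_vecMulVec, trace_vecMulVec]
  simp [smul_eq_mul, dotProduct_comm]

lemma norm_symProd_vecMulVec_sq (X : Matrix (Fin n) (Fin r) ℝ) (v : Fin n → ℝ) (w : Fin r → ℝ) :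
    ‖symProd X (vecMulVec v w)‖ ^ 2 =
      2 * ((X *ᵥ w ⬝ᵥ X *ᵥ w) * (v ⬝ᵥ v) + (X *ᵥ w ⬝ᵥ v) ^ 2) := by
  have h : (symProd X (vecMulVec v w)).1 = vecMulVec (X *ᵥ w) v + vecMulVec v (X *ᵥ w) := by
    rw [symProd_val, transpose_vecMulVec, mul_vecMulVec, vecMulVec_mul, vecMul_transpose]
  rw [SymMatrix.norm_sq, h, transpose_add, transpose_vecMulVec, transpose_vecMulVec,
    Matrix.add_mul, Matrix.mul_add, Matrix.mul_add]
  simp only [vecMulVec_mul_vecMulVec, trace_add, trace_vecMulVec, dotProduct_smul, smul_dotProduct,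
    smul_eq_mul, dotProduct_comm v]
  ring

end

/-! ### Sufficiency -/

section

variable {n r : ℕ} {φ : SymMatrix n → ℝ}

lemma trace_mul_posSemidef_nonneg {G : SymMatrix n} (hG : ∀ v, 0 ≤ v ⬝ᵥ G.1 *ᵥ v)
    {N : SymMatrix n} (hN : N.1.PosSemidef) : 0 ≤ inner ℝ G N := by
  obtain ⟨Z, hZ⟩ := exists_factor_of_rank hN rfl
  rw [SymMatrix.inner_eq, G.isSymm, hZ, ← Matrix.mul_assoc, trace_mul_comm, ← Matrix.mul_assoc,
    trace]
  refine Finset.sum_nonneg fun j _ => ?_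
  have : (Zᵀ * G.1 * Z).diag j = Z.col j ⬝ᵥ G.1 *ᵥ Z.col j := by
    rw [Matrix.mul_assoc]
    simp [mul_apply, mulVec, dotProduct]
  rw [this]
  exact hG _

lemma nontrivial_symMatrix (hn : 0 < n) : Nontrivial (SymMatrix n) := by
  refine ⟨⟨1, by simp [symSubmodule, IsSymm]⟩, 0, fun h => ?_⟩
  have h1 := congrArg (fun M : SymMatrix n => M.1 ⟨0, hn⟩ ⟨0, hn⟩) h
  simp at h1

/-- A second-order point of an overparameterized factorization minimizes `φ` over all positive
semidefinite matrices. -/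
theorem isPSDMinimizer_outer_of_isSecondOrderPoint {rs : ℕ} (hrs : rs ≤ r) (hn : 0 < n) {L μ : ℝ}
    {M : SymMatrix n} (hφ : SmoothStronglyConvex L μ φ) (hM : IsPSDMinimizer φ M)
    (hrank : M.1.rank = rs) (hK : 1 / 4 * (L / μ - 1) ^ 2 * (rs : ℝ) < r)
    {X : Matrix (Fin n) (Fin r) ℝ} (hX : IsSecondOrderPoint (bm r φ) X) :
    IsPSDMinimizer φ (outer X) := by
  have := nontrivial_symMatrix hn
  have hL := hφ.le_of_nontrivial
  rw [(derivatives_bm hφ.differentiable hφ.differentiable_fderiv).2.2] at hX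
  obtain ⟨hX1, hX2⟩ := hX
  obtain ⟨Z, hZ⟩ := exists_factor_of_rank hM.1 hrank
  obtain ⟨G, hG⟩ := SymMatrix.exists_gradient (fderiv ℝ φ (outer X))
  obtain ⟨H, hH⟩ := SymMatrix.exists_gradient (fderiv ℝ φ M)
  have hGX : G.1 * X = 0 := by
    -- Testing criticality on V = GX gives ‖GX‖² = 0.
    have h1 := hX1 (G.1 * X)
    rw [hG, inner_symProd] at h1
    exact eq_zero_of_trace_le_zero (by linarith)
  have hcurv : ∀ (v : Fin n → ℝ) (w : Fin r → ℝ), 0 ≤ (w ⬝ᵥ w) * (v ⬝ᵥ G.1 *ᵥ v) +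
      L * ((X *ᵥ w ⬝ᵥ X *ᵥ w) * (v ⬝ᵥ v) + (X *ᵥ w ⬝ᵥ v) ^ 2) := by
    intro v w
    have h1 := hX2 (vecMulVec v w)
    have h2 := hφ.smooth (outer X) (symProd X (vecMulVec v w))
    rw [norm_symProd_vecMulVec_sq] at h2
    rw [hG, inner_outer_vecMulVec] at h1
    linarith
  -- Complementary slackness: compare M with 0 and 2M on its ray in the cone.
  have hHM : inner ℝ H M = 0 := by
    have h1 := hM.fderiv_nonneg hφ.differentiable (N := 0) PosSemidef.zero
    have h2 := hM.fderiv_nonneg hφ.differentiable (N := (2 : ℝ) • M)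
      (hM.1.smul (by norm_num : (0 : ℝ) ≤ 2))
    rw [hH, inner_sub_right, real_inner_smul_right] at h2
    rw [hH, zero_sub, inner_neg_right] at h1
    linarith
  have hHN : ∀ N : SymMatrix n, N.1.PosSemidef → 0 ≤ inner ℝ H N := by
    intro N hN
    have h1 := hM.fderiv_nonneg hφ.differentiable hN
    rw [hH, inner_sub_right, hHM] at h1
    linarith
  have hHv : ∀ v, 0 ≤ v ⬝ᵥ H.1 *ᵥ v := fun v => by
    rw [← inner_outer_replicateCol]
    exact hHN _ (posSemidef_outer _)
  have hE : (outer X - M).1 = X * Xᵀ - Z * Zᵀ := by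
    rw [SymMatrix.sub_val, hZ, outer_val]
  have hco := hφ.gradient_difference_bound hL (M := outer X) (N := M) (D := G - H)
    (fun W => by rw [hG, hH, inner_sub_left])
  have hHE : 0 ≤ inner ℝ H (outer X - M) := by
    rw [inner_sub_right, hHM, sub_zero]
    exact hHN _ (posSemidef_outer X)
  rw [SymMatrix.norm_sq, SymMatrix.norm_sq, SymMatrix.inner_eq, hE, SymMatrix.sub_val] at hco
  rw [SymMatrix.inner_eq, hE] at hHE
  rcases eq_or_gradient_nonneg hφ.pos hL hrs hK G.isSymm hGX hcurv hHv hHE hco with h | h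
  · have : outer X = M := SymMatrix.ext (by rw [hZ, outer_val, h])
    rw [this]
    exact hM
  · refine ⟨posSemidef_outer X, fun N hN => ?_⟩
    have h1 := hφ.fderiv_le_sub (outer X) N
    have h2 : inner ℝ G (outer X) = 0 := by
      rw [inner_outer, Matrix.mul_assoc, hGX, Matrix.mul_zero, trace_zero]
    rw [hG, inner_sub_right, h2] at h1
    have h3 := trace_mul_posSemidef_nonneg h hN
    linarith

end

/-! ### Quadratic functions with a rank-one Hessian correction -/

section Quadratic

variable {S : Type*} [NormedAddCommGroup S] [InnerProductSpace ℝ S]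

/-- The quadratic function with minimizer `M₀` and Hessian `L ‖E‖² - τ ⟪A, E⟫²`. -/
noncomputable def rankOneQuadratic (L τ : ℝ) (A M₀ : S) (M : S) : ℝ :=
  L / 2 * ‖M - M₀‖ ^ 2 - τ / 2 * inner ℝ A (M - M₀) ^ 2

lemma hasFDerivAt_rankOneQuadratic (L τ : ℝ) (A M₀ M : S) :
    HasFDerivAt (rankOneQuadratic L τ A M₀)
      (innerSL ℝ (L • (M - M₀) - (τ * inner ℝ A (M - M₀)) • A)) M := by
  have h0 : HasFDerivAt (fun M : S => M - M₀) (ContinuousLinearMap.id ℝ S) M :=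
    (hasFDerivAt_id M).sub_const M₀
  have h1 := (h0.norm_sq).const_mul (L / 2)
  have h2 := (((innerSL ℝ A).hasFDerivAt.comp M h0).pow 2).const_mul (τ / 2)
  refine (h1.sub h2).congr_fderiv ?_
  ext1 W
  simp
  ring

lemma fderiv_rankOneQuadratic (L τ : ℝ) (A M₀ M W : S) :
    fderiv ℝ (rankOneQuadratic L τ A M₀) M W =
      inner ℝ (L • (M - M₀) - (τ * inner ℝ A (M - M₀)) • A) W := by
  rw [(hasFDerivAt_rankOneQuadratic L τ A M₀ M).fderiv]
  rfl

lemma hasFDerivAt_fderiv_rankOneQuadratic (L τ : ℝ) (A M₀ M : S) :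
    ∃ B : S →L[ℝ] S →L[ℝ] ℝ, HasFDerivAt (fderiv ℝ (rankOneQuadratic L τ A M₀)) B M ∧ ∀ E,
      B E E = L * ‖E‖ ^ 2 - τ * inner ℝ A E ^ 2 := by
  have h0 : HasFDerivAt (fun M : S => M - M₀) (ContinuousLinearMap.id ℝ S) M :=
    (hasFDerivAt_id M).sub_const M₀
  have h1 : fderiv ℝ (rankOneQuadratic L τ A M₀) = fun M =>
      innerSL ℝ (L • (M - M₀) - (τ * inner ℝ A (M - M₀)) • A) :=
    funext fun M => (hasFDerivAt_rankOneQuadratic L τ A M₀ M).fderiv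
  have h2 := ((innerSL ℝ A).hasFDerivAt.comp M h0).const_mul τ
  have h3 := (innerSL ℝ (E := S)).hasFDerivAt.comp M ((h0.const_smul L).sub (h2.smul_const A))
  rw [h1]
  refine ⟨_, h3, fun E => ?_⟩
  simp only [_root_.sub_apply, _root_.smul_apply, map_sub, map_smul, smul_eq_mul,
    ContinuousLinearMap.comp_apply, ContinuousLinearMap.smulRight_apply,
    ContinuousLinearMap.id_apply]
  change L * inner ℝ E E - τ * inner ℝ A E * inner ℝ A E = _
  rw [real_inner_self_eq_norm_sq]
  ring

lemma second_fderiv_rankOneQuadratic (L τ : ℝ) (A M₀ M E : S) :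
    fderiv ℝ (fderiv ℝ (rankOneQuadratic L τ A M₀)) M E E =
      L * ‖E‖ ^ 2 - τ * inner ℝ A E ^ 2 := by
  obtain ⟨B, hB, h⟩ := hasFDerivAt_fderiv_rankOneQuadratic L τ A M₀ M
  rw [hB.fderiv, h]

lemma smoothStronglyConvex_rankOneQuadratic {L μ τ : ℝ} {A : S} (hμ : 0 < μ) (hτ : 0 ≤ τ)
    (hA : τ * ‖A‖ ^ 2 ≤ L - μ) (M₀ : S) :
    SmoothStronglyConvex L μ (rankOneQuadratic L τ A M₀) where
  pos := hμ
  differentiable M := (hasFDerivAt_rankOneQuadratic L τ A M₀ M).differentiableAt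
  differentiable_fderiv M := by
    obtain ⟨B, hB, -⟩ := hasFDerivAt_fderiv_rankOneQuadratic L τ A M₀ M
    exact hB.differentiableAt
  strongly_convex M E := by
    rw [second_fderiv_rankOneQuadratic]
    have h1 : inner ℝ A E ^ 2 ≤ ‖A‖ ^ 2 * ‖E‖ ^ 2 := by
      rw [← mul_pow, sq_le_sq, abs_of_nonneg (by positivity : 0 ≤ ‖A‖ * ‖E‖)]
      exact abs_real_inner_le_norm A E
    have h2 := mul_le_mul_of_nonneg_left h1 hτ
    have h3 := mul_le_mul_of_nonneg_right hA (sq_nonneg ‖E‖)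
    linarith
  smooth M E := by
    rw [second_fderiv_rankOneQuadratic]
    have := mul_nonneg hτ (sq_nonneg (inner ℝ A E))
    linarith

lemma rankOneQuadratic_self (L τ : ℝ) (A M₀ : S) : rankOneQuadratic L τ A M₀ M₀ = 0 := by
  simp [rankOneQuadratic]

lemma rankOneQuadratic_nonneg {L μ τ : ℝ} {A : S} (hμ : 0 < μ) (hτ : 0 ≤ τ)
    (hA : τ * ‖A‖ ^ 2 ≤ L - μ) (M₀ M : S) : 0 ≤ rankOneQuadratic L τ A M₀ M := by
  have h := (smoothStronglyConvex_rankOneQuadratic hμ hτ hA M₀).fderiv_le_sub M₀ M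
  rw [rankOneQuadratic_self, fderiv_rankOneQuadratic] at h
  simpa using h

end Quadratic

lemma isQuadratic_rankOneQuadratic {n : ℕ} (L τ : ℝ) (A M₀ : SymMatrix n) :
    IsQuadratic (rankOneQuadratic L τ A M₀) := by
  refine ⟨LinearMap.BilinMap.toQuadraticMap ((L / 2) • innerₗ (SymMatrix n) -
    (τ / 2) • (innerₗ (SymMatrix n) A).smulRight (innerₗ (SymMatrix n) A)),
    (τ * inner ℝ A M₀) • innerₗ (SymMatrix n) A - L • innerₗ (SymMatrix n) M₀,
    rankOneQuadratic L τ A M₀ 0, fun M => ?_⟩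
  simp [rankOneQuadratic, inner_sub_right, norm_sub_sq_real, real_inner_comm M₀ M]
  ring

/-! ### The spurious point of a diagonal quadratic -/

/-- The diagonal symmetric matrix with the given diagonal. -/
def SymMatrix.diag {n : ℕ} (d : Fin n → ℝ) : SymMatrix n :=
  ⟨diagonal d, by simp [symSubmodule, IsSymm]⟩

section Diag

variable {n : ℕ}

lemma SymMatrix.diag_val (d : Fin n → ℝ) : (SymMatrix.diag d).1 = diagonal d := rfl

lemma SymMatrix.inner_diag (d : Fin n → ℝ) (M : SymMatrix n) :
    inner ℝ (SymMatrix.diag d) M = ∑ i, d i * M.1 i i := by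
  rw [SymMatrix.inner_eq, SymMatrix.diag_val, diagonal_transpose, trace]
  simp [diagonal_mul]

lemma SymMatrix.inner_diag_diag (d e : Fin n → ℝ) :
    inner ℝ (SymMatrix.diag d) (SymMatrix.diag e) = ∑ i, d i * e i := by
  rw [SymMatrix.inner_diag]
  simp [SymMatrix.diag_val]

lemma sum_lt_or_eq {k r : ℕ} (hk : k ≤ r) (hr : r < n) (x y : ℝ) :
    ∑ i : Fin n, (if i.val < k then x else if i.val = r then y else 0) = k * x + y := by
  have h : ∀ i : Fin n, (if i.val < k then x else if i.val = r then y else 0) =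
      (if i.val < k then x else 0) + if i = ⟨r, hr⟩ then y else 0 := by
    intro i
    simp only [Fin.ext_iff]
    split_ifs <;> first | omega | simp
  simp only [h, Finset.sum_add_distrib, Finset.sum_ite_eq', Finset.mem_univ, if_true]
  rw [← Finset.sum_filter, Finset.sum_const, nsmul_eq_mul, Fin.card_filter_val_lt,
    min_eq_right (by omega)]

lemma rank_diagonal_Icc {k r : ℕ} (hk : k ≤ r) (hr : r < n) {d : Fin n → ℝ}
    (hd : ∀ i, d i ≠ 0 ↔ k ≤ i.val ∧ i.val ≤ r) : (diagonal d).rank = r + 1 - k := by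
  rw [rank_diagonal, Fintype.card_subtype]
  have : Finset.univ.filter (fun i => d i ≠ 0) =
      Finset.Icc (⟨k, by omega⟩ : Fin n) ⟨r, hr⟩ := by
    ext i
    simp [hd, Fin.le_def]
  rw [this, Fin.card_Icc]

end Diag

lemma exists_outer_eq_of_rank_le {n r s : ℕ} (hs : s ≤ r) {M : SymMatrix n} (hM : M.1.PosSemidef)
    (hr : M.1.rank = s) : ∃ U : Matrix (Fin n) (Fin r) ℝ, outer U = M := by
  obtain ⟨Z, hZ⟩ := exists_factor_of_rank hM hr
  obtain ⟨d, rfl⟩ := Nat.exists_eq_add_of_le hs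
  refine ⟨of fun i => Fin.addCases (Z i) fun _ => 0, SymMatrix.ext ?_⟩
  rw [hZ, outer_val]
  ext i j
  simp [mul_apply, Fin.sum_univ_add]

/-- The `n × r` matrix whose columns are the first `r` standard basis vectors. -/
def firstColumns (n r : ℕ) : Matrix (Fin n) (Fin r) ℝ :=
  of fun i j => if i.val = j.val then 1 else 0

section FirstColumns

variable {n r : ℕ}

lemma outer_firstColumns :
    outer (firstColumns n r) = SymMatrix.diag fun i => if i.val < r then 1 else 0 := by
  refine SymMatrix.ext ?_
  rw [outer_val, SymMatrix.diag_val]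
  ext i j
  simp only [mul_apply, transpose_apply, firstColumns, of_apply, diagonal_apply, ite_mul, one_mul,
    zero_mul]
  by_cases hi : i.val < r
  · rw [Finset.sum_eq_single ⟨i.val, hi⟩]
    · simp [hi, Fin.ext_iff, eq_comm]
    · intro l _ hl
      rw [if_neg]
      intro h
      exact hl (Fin.ext h.symm)
    · simp
  · rw [Finset.sum_eq_zero]
    · simp [hi]
    · intro l _
      rw [if_neg]
      have := l.isLt
      omega

lemma firstColumns_apply_of_le {i : Fin n} (hi : r ≤ i.val) (j : Fin r) :
    firstColumns n r i j = 0 := by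
  have := j.isLt
  simp only [firstColumns, of_apply]
  rw [if_neg (by omega)]

lemma symProd_firstColumns_castLE (hr : r < n) (V : Matrix (Fin n) (Fin r) ℝ) (j : Fin r) :
    (symProd (firstColumns n r) V).1 ⟨r, hr⟩ (Fin.castLE hr.le j) = V ⟨r, hr⟩ j := by
  rw [symProd_val, Matrix.add_apply, mul_apply, mul_apply]
  simp only [transpose_apply, firstColumns_apply_of_le (i := ⟨r, hr⟩) le_rfl, zero_mul,
    Finset.sum_const_zero, zero_add]
  simp [firstColumns, ← Fin.ext_iff]

lemma symProd_firstColumns_last (hr : r < n) (V : Matrix (Fin n) (Fin r) ℝ) :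
    (symProd (firstColumns n r) V).1 ⟨r, hr⟩ ⟨r, hr⟩ = 0 := by
  rw [symProd_val, Matrix.add_apply, mul_apply, mul_apply]
  simp [firstColumns_apply_of_le (i := (⟨r, hr⟩ : Fin n)) le_rfl]

/-- Keep only the diagonal, row r and column r. Their one common entry (r, r) is zero, so nothing is
counted twice. -/
lemma norm_symProd_firstColumns_sq_ge (hr : r < n) (V : Matrix (Fin n) (Fin r) ℝ) :
    ∑ i, (symProd (firstColumns n r) V).1 i i ^ 2 + 2 * ∑ j, V ⟨r, hr⟩ j ^ 2 ≤
      ‖symProd (firstColumns n r) V‖ ^ 2 := by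
  set ρ : Fin n := ⟨r, hr⟩ with hρ
  set S := symProd (firstColumns n r) V with hS
  have hS0 : S.1 ρ ρ = 0 := symProd_firstColumns_last hr V
  have h1 : ∑ j, V ρ j ^ 2 ≤ ∑ j, S.1 ρ j ^ 2 := by
    calc ∑ j, V ρ j ^ 2 = ∑ j, S.1 ρ (Fin.castLEEmb hr.le j) ^ 2 :=
          Finset.sum_congr rfl fun j _ => by
            rw [← symProd_firstColumns_castLE hr V j]; rfl
      _ = ∑ j ∈ Finset.univ.map (Fin.castLEEmb hr.le), S.1 ρ j ^ 2 := by rw [Finset.sum_map]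
      _ ≤ _ := Finset.sum_le_univ_sum_of_nonneg fun j => sq_nonneg _
  have hsymm : ∀ i, S.1 i ρ = S.1 ρ i := fun i => congrFun (congrFun S.isSymm ρ) i
  have h2 : ∀ i j, (if i = j then S.1 i j ^ 2 else 0) + (if i = ρ then S.1 ρ j ^ 2 else 0) +
      (if j = ρ then S.1 ρ i ^ 2 else 0) ≤ S.1 i j ^ 2 := by
    intro i j
    by_cases hi : i = ρ
    · by_cases hj : j = ρ
      · subst hi; subst hj; simp [hS0]
      · have : ¬ ρ = j := fun h => hj h.symm
        simp [hi, hj, this]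
    · by_cases hj : j = ρ
      · simp [hi, hj, hsymm]
      · simp only [hi, hj, if_false, add_zero]
        split_ifs
        · exact le_rfl
        · exact sq_nonneg _
  have h3 := Finset.sum_le_sum fun i (_ : i ∈ Finset.univ) =>
    Finset.sum_le_sum fun j (_ : j ∈ Finset.univ) => h2 i j
  rw [SymMatrix.norm_sq, trace_transpose_mul_self_eq_sum]
  refine le_trans ?_ h3
  have h4 : ∑ i, ∑ j, (if i = ρ then S.1 ρ j ^ 2 else 0) = ∑ j, S.1 ρ j ^ 2 := by
    rw [Finset.sum_comm]; simp
  simp only [Finset.sum_add_distrib, h4]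
  simp only [Finset.sum_ite_eq, Finset.sum_ite_eq', Finset.mem_univ, if_true]
  linarith

end FirstColumns

/-- The gradient costs 2L ∑ V_rj², exactly what L‖S‖² gains from row and column r of S. By
Cauchy–Schwarz the rank-one term is absorbed by the diagonal of S. -/
lemma isSecondOrderPoint_firstColumns {n r : ℕ} (hr : r < n) {L τ : ℝ} (hτ : 0 ≤ τ)
    {a : Fin n → ℝ} {M₀ : SymMatrix n} (hA : τ * ∑ i, a i ^ 2 ≤ L)
    (hgrad : L • (outer (firstColumns n r) - M₀) -
      (τ * inner ℝ (SymMatrix.diag a) (outer (firstColumns n r) - M₀)) • SymMatrix.diag a =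
      SymMatrix.diag fun i => if i = ⟨r, hr⟩ then -L else 0) :
    IsSecondOrderPoint (bm r (rankOneQuadratic L τ (SymMatrix.diag a) M₀)) (firstColumns n r) := by
  have hd : Differentiable ℝ (rankOneQuadratic L τ (SymMatrix.diag a) M₀) := fun M =>
    (hasFDerivAt_rankOneQuadratic L τ _ M₀ M).differentiableAt
  have hd' : Differentiable ℝ (fderiv ℝ (rankOneQuadratic L τ (SymMatrix.diag a) M₀)) := fun M => by
    obtain ⟨B, hB, -⟩ := hasFDerivAt_fderiv_rankOneQuadratic L τ (SymMatrix.diag a) M₀ M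
    exact hB.differentiableAt
  rw [(derivatives_bm hd hd').2.2]
  refine ⟨fun V => ?_, fun V => ?_⟩
  · rw [fderiv_rankOneQuadratic, hgrad, inner_symProd, SymMatrix.diag_val]
    have : diagonal (fun i => if i = (⟨r, hr⟩ : Fin n) then -L else 0) * firstColumns n r = 0 := by
      ext i j
      rw [diagonal_mul]
      split_ifs with hi
      · rw [firstColumns_apply_of_le (by rw [hi]), mul_zero]; rfl
      · simp
    rw [this]
    simp
  · rw [fderiv_rankOneQuadratic, hgrad, second_fderiv_rankOneQuadratic, SymMatrix.inner_diag,
      SymMatrix.inner_diag]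
    set S := symProd (firstColumns n r) V with hS
    have h1 := norm_symProd_firstColumns_sq_ge hr V
    have h2 : (∑ i, a i * S.1 i i) ^ 2 ≤ (∑ i, a i ^ 2) * ∑ i, S.1 i i ^ 2 :=
      Finset.sum_mul_sq_le_sq_mul_sq _ _ _
    have h3 : ∑ i, (if i = ⟨r, hr⟩ then -L else 0) * (outer V).1 i i =
        -L * ∑ j, V ⟨r, hr⟩ j ^ 2 := by
      simp only [ite_mul, zero_mul, Finset.sum_ite_eq', Finset.mem_univ, if_true]
      rw [outer_val, mul_apply]
      simp [sq]
    have h4 : 0 ≤ ∑ i, S.1 i i ^ 2 := Finset.sum_nonneg fun i _ => sq_nonneg _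
    have h5 := mul_le_mul_of_nonneg_left h2 hτ
    have h6 := mul_le_mul_of_nonneg_right hA h4
    have hL : 0 ≤ L := le_trans (mul_nonneg hτ (Finset.sum_nonneg fun i _ => sq_nonneg _)) hA
    have h7 := mul_le_mul_of_nonneg_left h1 hL
    rw [h3]
    linarith

/-- The quadratic counterexample with a spurious second-order point. -/
theorem exists_quadratic_with_spurious_point {n r rs : ℕ} (hrs : rs ≤ r) (hrn : r < n) {L μ : ℝ}
    (h1 : 1 ≤ rs) (hμ : 0 < μ) (hL : μ ≤ L)
    (hκ : (r : ℝ) ≤ 1 / 4 * (L / μ - 1) ^ 2 + (rs : ℝ) - 1) :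
    ∃ φ₀ : SymMatrix n → ℝ, IsQuadratic φ₀ ∧ SmoothStronglyConvex L μ φ₀ ∧
      (∃ M₀ : SymMatrix n, IsPSDMinimizer φ₀ M₀ ∧ M₀.1.rank = rs) ∧
      ∃ X : Matrix (Fin n) (Fin r) ℝ, IsSecondOrderPoint (bm r φ₀) X ∧
        ∃ m : ℝ, IsLeast (Set.range (bm (n := n) r φ₀)) m ∧ μ < bm r φ₀ X - m := by
  obtain ⟨k, hk⟩ : ∃ k, k = r - rs + 1 := ⟨_, rfl⟩
  have hkr : k ≤ r := by omega
  have hk1 : (1 : ℝ) ≤ k := by exact_mod_cast (by omega : 1 ≤ k)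
  have hkR : (k : ℝ) = r - rs + 1 := by rw [hk]; push_cast [hrs]; ring
  have hL0 : 0 < L := hμ.trans_le hL
  set κ := L / μ with hκdef
  have hκL : L = κ * μ := by rw [hκdef]; field_simp
  have hκ1 : 1 ≤ κ := (one_le_div hμ).2 hL
  have hkκ : (k : ℝ) ≤ 1 / 4 * (κ - 1) ^ 2 := by rw [hkR]; linarith
  have hκ3 : 3 ≤ κ := by nlinarith
  -- This t maximizes (t - 1)(κ - t), with maximum (κ - 1)²/4; the strong convexity requirement
  -- `hcond` amounts to k ≤ (t - 1)(κ - t).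
  obtain ⟨t, ht⟩ : ∃ t, t = (κ + 1) / 2 := ⟨_, rfl⟩
  have ht2 : 2 ≤ t := by rw [ht]; linarith
  obtain ⟨q, hq⟩ : ∃ q : ℝ, q = k + t * (t - 1) := ⟨_, rfl⟩
  have hq0 : 0 < q := by rw [hq]; nlinarith
  -- Since q = ⟨A, E⟩ for E = XXᵀ - M₀, this makes the gradient at X equal to L(E - A), supported on
  -- the entry (r, r).
  set τ := L / q with hτ
  have hτ0 : 0 ≤ τ := by positivity
  have hτq : τ * q = L := by rw [hτ]; field_simp
  set a : Fin n → ℝ := fun i => if i.val < k then 1 else if i.val = r then -(t - 1) else 0 with ha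
  set m₀ : Fin n → ℝ := fun i => if i.val < k then 0 else if i.val < r then 1 else
    if i.val = r then t else 0 with hm₀
  set e : Fin n → ℝ := fun i => if i.val < k then 1 else if i.val = r then -t else 0 with he
  set A := SymMatrix.diag a
  set M₀ := SymMatrix.diag m₀
  have hE : outer (firstColumns n r) - M₀ = SymMatrix.diag e := by
    rw [outer_firstColumns]
    refine SymMatrix.ext ?_
    rw [SymMatrix.sub_val, SymMatrix.diag_val, SymMatrix.diag_val, SymMatrix.diag_val, diagonal_sub]
    congr 1
    ext i
    simp only [hm₀, he]
    split_ifs <;> first | omega | simp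
  have hae : inner ℝ A (SymMatrix.diag e) = q := by
    rw [SymMatrix.inner_diag_diag, hq]
    have : ∀ i, a i * e i = if i.val < k then 1 else if i.val = r then t * (t - 1) else 0 := by
      intro i
      simp only [ha, he]
      split_ifs <;> ring
    simp only [this]
    rw [sum_lt_or_eq hkr hrn, mul_one]
  have haa : ∑ i, a i ^ 2 = k + (t - 1) ^ 2 := by
    have : ∀ i, a i ^ 2 = if i.val < k then 1 else if i.val = r then (t - 1) ^ 2 else 0 := by
      intro i
      simp only [ha]
      split_ifs <;> ring
    simp only [this]
    rw [sum_lt_or_eq hkr hrn, mul_one]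
  have hee : ‖SymMatrix.diag e‖ ^ 2 = k + t ^ 2 := by
    rw [← real_inner_self_eq_norm_sq, SymMatrix.inner_diag_diag]
    have : ∀ i, e i * e i = if i.val < k then 1 else if i.val = r then t ^ 2 else 0 := by
      intro i
      simp only [he]
      split_ifs <;> ring
    simp only [this]
    rw [sum_lt_or_eq hkr hrn, mul_one]
  have hAn : ‖A‖ ^ 2 = ∑ i, a i ^ 2 := by
    rw [← real_inner_self_eq_norm_sq, SymMatrix.inner_diag_diag]
    simp only [sq]
  have hcond : τ * ∑ i, a i ^ 2 ≤ L - μ := by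
    rw [haa, hτ, div_mul_eq_mul_div, div_le_iff₀ hq0, hq, hκL]
    have : κ * (k + (t - 1) ^ 2) ≤ (κ - 1) * (k + t * (t - 1)) := by
      rw [ht]; nlinarith
    nlinarith
  have hpsd : M₀.1.PosSemidef := by
    rw [SymMatrix.diag_val]
    refine PosSemidef.diagonal fun i => ?_
    simp only [hm₀, Pi.zero_apply]
    split_ifs <;> linarith
  have hrank : M₀.1.rank = rs := by
    rw [SymMatrix.diag_val, rank_diagonal_Icc hkr hrn]
    · omega
    · intro i
      have : t ≠ 0 := by linarith
      simp only [hm₀]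
      split_ifs <;> simp [this] <;> omega
  have hcond' : τ * ‖A‖ ^ 2 ≤ L - μ := by rw [hAn]; exact hcond
  have hnonneg := rankOneQuadratic_nonneg hμ hτ0 hcond' M₀
  obtain ⟨U, hU⟩ := exists_outer_eq_of_rank_le hrs hpsd hrank
  refine ⟨rankOneQuadratic L τ A M₀, isQuadratic_rankOneQuadratic L τ A M₀,
    smoothStronglyConvex_rankOneQuadratic hμ hτ0 hcond' M₀,
    ⟨M₀, ⟨hpsd, fun N _ => ?_⟩, hrank⟩, firstColumns n r,
    isSecondOrderPoint_firstColumns hrn hτ0 (hcond.trans (by linarith)) ?_, 0, ⟨⟨U, ?_⟩, ?_⟩, ?_⟩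
  · rw [rankOneQuadratic_self]; exact hnonneg N
  · rw [hE, hae, hτq]
    refine SymMatrix.ext ?_
    rw [SymMatrix.sub_val, SymMatrix.smul_val, SymMatrix.smul_val, SymMatrix.diag_val,
      SymMatrix.diag_val, SymMatrix.diag_val, ← smul_sub, diagonal_sub, ← diagonal_smul]
    congr 1
    ext i
    simp only [he, ha, Pi.smul_apply, smul_eq_mul, Fin.ext_iff]
    split_ifs <;> first | omega | ring
  · rw [bm, hU, rankOneQuadratic_self]
  · rintro _ ⟨V, rfl⟩
    exact hnonneg _
  · rw [bm, rankOneQuadratic, hE, hae, hee]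
    -- The gap is Lt/2, at least 3μ because κ ≥ 3 and t ≥ 2.
    have h2 : τ / 2 * q ^ 2 = L / 2 * q := by rw [← hτq]; ring
    rw [h2, hq]
    nlinarith

/-! ### Bounds on the best condition number -/

/-- Every counterexample has condition number at least `1 + 2 √(r / rs)`. -/
lemma le_of_isCounterexample {n r rs : ℕ} (hrn : r < n) (h1 : 1 ≤ rs) {κ : ℝ}
    {φ : SymMatrix n → ℝ} (h : IsCounterexample κ r rs φ) :
    1 + 2 * √((r : ℝ) / (rs : ℝ)) ≤ κ := by
  obtain ⟨⟨L, μ, hφ, hκ⟩, M, hM, hrank, hrs, X, hX, hX2⟩ := h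
  have := nontrivial_symMatrix (show 0 < n by omega)
  have hL := (one_le_div hφ.pos).2 hφ.le_of_nontrivial
  by_contra! hlt
  have hrs0 : (0 : ℝ) < rs := by exact_mod_cast h1
  have hK : 1 / 4 * (L / μ - 1) ^ 2 * (rs : ℝ) < r := by
    have h2 : (L / μ - 1) / 2 < √((r : ℝ) / rs) := by linarith
    have h3 := (Real.lt_sqrt (by linarith)).1 h2
    rw [lt_div_iff₀ hrs0] at h3
    linarith
  have h4 := isPSDMinimizer_outer_of_isSecondOrderPoint hrs (by omega) hφ hM hrank hK hX2
  exact hX (hM.eq hφ h4.1 (h4.2 M hM.1))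

lemma mem_counterexampleSet {n r rs : ℕ} (hrs : rs ≤ r) (hrn : r < n) (h1 : 1 ≤ rs) :
    1 + 2 * √((r : ℝ) - (rs : ℝ) + 1) ∈ counterexampleSet n r rs := by
  have hrs' : (rs : ℝ) ≤ r := by exact_mod_cast hrs
  have hs : √((r : ℝ) - rs + 1) ^ 2 = r - rs + 1 := Real.sq_sqrt (by linarith)
  have hs0 := Real.sqrt_nonneg ((r : ℝ) - rs + 1)
  obtain ⟨φ, -, hφ, ⟨M, hM, hrank⟩, X, hX, m, hm, hlt⟩ :=
    exists_quadratic_with_spurious_point hrs hrn (L := 1 + 2 * √((r : ℝ) - rs + 1)) (μ := 1) h1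
      one_pos (by linarith) (by rw [div_one]; nlinarith)
  refine ⟨φ, ⟨_, 1, hφ, (div_one _).le⟩, M, hM, hrank, hrs, X, fun h => ?_, hX⟩
  obtain ⟨U, rfl⟩ := hm.1
  have := hM.2 (outer U) (posSemidef_outer U)
  rw [bm, bm, h] at hlt
  linarith

end BurerMonteiro

theorem theorem1 (n r rs : ℕ) (hrs : rs ≤ r) (hrn : r < n) :
    -- sufficiency
    (∀ (L μ : ℝ) (φ : BurerMonteiro.SymMatrix n → ℝ) (Mstar : BurerMonteiro.SymMatrix n),
      BurerMonteiro.SmoothStronglyConvex L μ φ →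
      BurerMonteiro.IsPSDMinimizer φ Mstar →
      Mstar.1.rank = rs →
      1 / 4 * (L / μ - 1) ^ 2 * (rs : ℝ) < (r : ℝ) →
      ∀ X : Matrix (Fin n) (Fin r) ℝ,
        BurerMonteiro.IsSecondOrderPoint (BurerMonteiro.bm r φ) X ↔
          ∀ U : Matrix (Fin n) (Fin r) ℝ,
            BurerMonteiro.bm r φ X ≤ BurerMonteiro.bm r φ U) ∧
    -- necessity
    (∀ L μ : ℝ, 1 ≤ rs → 0 < μ → μ ≤ L →
      (r : ℝ) ≤ 1 / 4 * (L / μ - 1) ^ 2 + (rs : ℝ) - 1 →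
      ∃ φ₀ : BurerMonteiro.SymMatrix n → ℝ,
        BurerMonteiro.IsQuadratic φ₀ ∧
        BurerMonteiro.SmoothStronglyConvex L μ φ₀ ∧
        (∃ M₀ : BurerMonteiro.SymMatrix n, BurerMonteiro.IsPSDMinimizer φ₀ M₀ ∧
          M₀.1.rank = rs) ∧
        ∃ Xspur : Matrix (Fin n) (Fin r) ℝ,
          BurerMonteiro.IsSecondOrderPoint (BurerMonteiro.bm r φ₀) Xspur ∧
          ∃ m : ℝ, IsLeast (Set.range (BurerMonteiro.bm (n := n) r φ₀)) m ∧
            μ < BurerMonteiro.bm r φ₀ Xspur - m) ∧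
    -- bounds on the best condition number of a counterexample
    (1 ≤ rs →
      (BurerMonteiro.counterexampleSet n r rs).Nonempty ∧
      BddBelow (BurerMonteiro.counterexampleSet n r rs) ∧
      1 + 2 * √((r : ℝ) / (rs : ℝ)) ≤ BurerMonteiro.kappaStar n r rs ∧
      BurerMonteiro.kappaStar n r rs ≤ 1 + 2 * √((r : ℝ) - (rs : ℝ) + 1)) := by
  have hn : 0 < n := by omega
  refine ⟨fun L μ φ Mstar hφ hM hrank hK X => ⟨fun hX U => ?_, fun hX => ?_⟩,
    fun L μ h1 hμ hL hκ =>
      BurerMonteiro.exists_quadratic_with_spurious_point hrs hrn h1 hμ hL hκ, fun h1 => ?_⟩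
  · exact (BurerMonteiro.isPSDMinimizer_outer_of_isSecondOrderPoint hrs hn hφ hM hrank hK hX).2 _
      (BurerMonteiro.posSemidef_outer U)
  · exact BurerMonteiro.isSecondOrderPoint_bm_of_forall_le hφ.differentiable
      hφ.differentiable_fderiv hX
  · have hmem := BurerMonteiro.mem_counterexampleSet hrs hrn h1
    have hlb : ∀ κ ∈ BurerMonteiro.counterexampleSet n r rs,
        1 + 2 * √((r : ℝ) / (rs : ℝ)) ≤ κ := fun κ ⟨_, h⟩ =>
      BurerMonteiro.le_of_isCounterexample hrn h1 h
    exact ⟨⟨_, hmem⟩, ⟨_, hlb⟩, le_csInf ⟨_, hmem⟩ hlb, csInf_le ⟨_, hlb⟩ hmem⟩
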